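/- \textbf{Setting.} Let $k\ge 1$, $n=2k+1$, and let $\mathbb{E}_1^{n}$ be $\mathbb{R}^n$ with $x\cdot y=-x_1y_1+x_2y_2+\dots+x_ny_n$ and $\|x\|=\sqrt{|x\cdot x|}$. A \emph{p-similarity} of $\mathbb{E}_1^n$ is a map $f(x)=\mu A x+b$ with $\mu\in\mathbb{R}\setminus\{0\}$, $b\in\mathbb{R}^n$, and $A$ pseudo-orthogonal with $\det A=1$. Let $\alpha:I\to\mathbb{E}_1^{n}$ ($I$ a non-empty open interval) be a non-null curve of class $C^n$ with Frenet frame $\mathbf e_1,\dots,\mathbf e_n$: the frame is differentiable and pseudo-orthonormal, $\mathbf e_i\cdot\mathbf e_j=\varepsilon_i\delta_{ij}$ with $\varepsilon_i=-1$ if $\mathbf e_i$ is timelike and $\varepsilon_i=1$ if it is spacelike, $\mathbf e_1=\alpha'/\|\alpha'\|$, and with $s$ the arc length and $\kappa_i=\frac{d\mathbf e_i}{ds}\cdot\mathbf e_{i+1}$, $$\tfrac{d\mathbf e_1}{ds}=\varepsilon_2\kappa_1\mathbf e_2,\qquad \tfrac{d\mathbf e_i}{ds}=-\varepsilon_{i-1}\kappa_{i-1}\mathbf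 e_{i-1}+\varepsilon_{i+1}\kappa_i\mathbf e_{i+1}\ (2\le i\le n-1),\qquad \tfrac{d\mathbf e_n}{ds}=-\varepsilon_{n-1}\kappa_{n-1}\mathbf e_{n-1},$$ $\kappa_i>0$ for $i\le n-2$ and $\kappa_{n-1}\neq0$. Assume that $\alpha$ is parametrized by a spherical arc length parameter $\sigma$, i.e. $\|d\mathbf e_1/d\sigma\|=1$. Its \emph{p-shape curvatures} are $\tilde\kappa_1=-\frac1{\kappa_1}\frac{d\kappa_1}{d\sigma}$ and $\tilde\kappa_i=\kappa_i/\kappa_1$ for $2\le i\le n-1$. The curve is self-similar in the sense that its p-shape curvatures are constant. Let $M$ be the tridiagonal $n\times n$ matrix with zero diagonal, $M_{i,i+1}=\varepsilon_{i+1}m_i$ and $M_{i+1,i}=-\varepsilon_i m_i$, where $m_1=1$ and $m_i=\tilde\kappa_i$ for $2\le i\le n-1$. \textbf{Theorem.} Let $\alpha:I\to\mathbb{E}_1^{2k+1}$ be such a non-null self-similar curve with constant p-shape curvatures $\tilde\kappa_1\ne0,\dots,\tilde\kappa_{2k}\neq0$. Let $\lambda_1,\dots,\lambda_k>0$ be such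 that $\lambda_1^2,-\lambda_2^2,\dots,-\lambda_k^2$ are pairwise different eigenvalues of $M^2$, and suppose $\lambda_1^2>\tilde\kappa_1^2$. Put $$b_1=\sqrt{\lambda_1^2-\tilde\kappa_1^2},\quad \theta_1=\lambda_1\sigma-\cosh^{-1}\frac{\lambda_1}{b_1},\qquad b_i=\sqrt{\lambda_i^2+\tilde\kappa_1^2},\quad \theta_i=\lambda_i\sigma+\cos^{-1}\frac{\lambda_i}{b_i}\quad(2\le i\le k).$$ \textbf{(i)} If $\mathbf e_1$ is timelike, there are non-zero real numbers $a_1,\dots,a_{k+1}$ such that, up to a p-similarity of $\mathbb{E}_1^{2k+1}$, $\alpha(\sigma)$ equals for all $\sigma\in I$ $$\Big(\tfrac{a_1}{b_1}e^{\tilde\kappa_1\sigma}\sinh\theta_1,\ \tfrac{a_1}{b_1}e^{\tilde\kappa_1\sigma}\cosh\theta_1,\ \tfrac{a_2}{b_2}e^{\tilde\kappa_1\sigma}\sin\theta_2,\ -\tfrac{a_2}{b_2}e^{\tilde\kappa_1\sigma}\cos\theta_2,\dots,\tfrac{a_k}{b_k}e^{\tilde\kappa_1\sigma}\sin\theta_k,\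 -\tfrac{a_k}{b_k}e^{\tilde\kappa_1\sigma}\cos\theta_k,\ a_{k+1}e^{\tilde\kappa_1\sigma}\Big).$$ Moreover, for the vectors determined by this parametrization (also denoted $\alpha$, defined for all $\sigma\in\mathbb R$) through $\mathbf e_1=e^{-\tilde\kappa_1\sigma}\frac{d\alpha}{d\sigma}$, $\mathbf e_2=\frac{d\mathbf e_1}{d\sigma}$, $\mathbf e_3=\frac1{\tilde\kappa_2}\big(-\mathbf e_1+\frac{d\mathbf e_2}{d\sigma}\big)$, $\mathbf e_{i+1}=\frac1{\tilde\kappa_i}\big(\tilde\kappa_{i-1}\mathbf e_{i-1}+\frac{d\mathbf e_i}{d\sigma}\big)$ for $i\ge3$, the numbers $a_i$ solve the quadratic system $\mathbf e_1\cdot\mathbf e_1=-1$, $\mathbf e_2\cdot\mathbf e_2=1$, $\mathbf e_3\cdot\mathbf e_3=1$ and $\mathbf e_i\cdot\mathbf e_i=1$ for $4\le i\le k+1$, the first three equations of which read $$-a_1^2+\sum_{i=2}^k a_i^2+\tilde\kappa_1^2a_{k+1}^2=-1,\qquad \sum_{i=1}^k a_i^2\lambda_i^2=1,$$ $$-a_1^2(1-\lambda_1^2)^2+\sum_{i=2}^k(1+\lambda_i^2)^2a_i^2+\tilde\kappa_1^2a_{k+1}^2=\tilde\kappa_2^2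 .$$ \textbf{(ii)} If $\mathbf e_2$ is timelike, there are non-zero real numbers $a_1,\dots,a_{k+1}$ such that, up to a p-similarity of $\mathbb{E}_1^{2k+1}$, $\alpha(\sigma)$ equals for all $\sigma\in I$ $$\Big(-\tfrac{a_1}{b_1}e^{\tilde\kappa_1\sigma}\cosh\theta_1,\ -\tfrac{a_1}{b_1}e^{\tilde\kappa_1\sigma}\sinh\theta_1,\ \tfrac{a_2}{b_2}e^{\tilde\kappa_1\sigma}\sin\theta_2,\ -\tfrac{a_2}{b_2}e^{\tilde\kappa_1\sigma}\cos\theta_2,\dots,\tfrac{a_k}{b_k}e^{\tilde\kappa_1\sigma}\sin\theta_k,\ -\tfrac{a_k}{b_k}e^{\tilde\kappa_1\sigma}\cos\theta_k,\ a_{k+1}e^{\tilde\kappa_1\sigma}\Big).$$ Moreover, for the vectors determined by this parametrization through $\mathbf e_1=e^{-\tilde\kappa_1\sigma}\frac{d\alpha}{d\sigma}$, $\mathbf e_2=-\frac{d\mathbf e_1}{d\sigma}$, $\mathbf e_3=\frac1{\tilde\kappa_2}\big(\mathbf e_1+\frac{d\mathbf e_2}{d\sigma}\big)$, $\mathbf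 e_4=\frac1{\tilde\kappa_3}\big(-\tilde\kappa_2\mathbf e_2+\frac{d\mathbf e_3}{d\sigma}\big)$, $\mathbf e_{i+1}=\frac1{\tilde\kappa_i}\big(\tilde\kappa_{i-1}\mathbf e_{i-1}+\frac{d\mathbf e_i}{d\sigma}\big)$ for $i\ge4$, the numbers $a_i$ solve the quadratic system $\mathbf e_1\cdot\mathbf e_1=1$, $\mathbf e_2\cdot\mathbf e_2=-1$, $\mathbf e_3\cdot\mathbf e_3=1$ and $\mathbf e_i\cdot\mathbf e_i=1$ for $4\le i\le k+1$, the first three equations of which read $$\sum_{i=1}^k a_i^2+\tilde\kappa_1^2a_{k+1}^2=1,\qquad -a_1^2\lambda_1^2+\sum_{i=2}^k a_i^2\lambda_i^2=-1,$$ $$a_1^2(1-\lambda_1^2)^2+\sum_{i=2}^k(1+\lambda_i^2)^2a_i^2+\tilde\kappa_1^2a_{k+1}^2=\tilde\kappa_2^2 .$$ -/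

import Mathlib

namespace Minkowski

/-! Vectors of Minkowski `n`-space are elements of `Fin n → ℝ` (the first coordinate is the time
coordinate). Frames, curvatures and constants are indexed from `1`, as is usual for Frenet frames:
`e 1, …, e n`, `κ 1, …, κ (n - 1)`; values at other indices are never used. -/

/-- The matrix `diag (-1, 1, …, 1)`. -/
def metric (n : ℕ) : Matrix (Fin n) (Fin n) ℝ :=
  Matrix.diagonal fun i => if (i : ℕ) = 0 then -1 else 1

/-- The Lorentzian inner product `x ⬝ y = xᵀ diag (-1, 1, …, 1) y`. -/
def lor {n : ℕ} (x y : Fin n → ℝ) : ℝ :=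
  x ⬝ᵥ (metric n).mulVec y

/-- The Lorentzian norm `‖x‖ = √|x ⬝ x|`. -/
noncomputable def lnorm {n : ℕ} (x : Fin n → ℝ) : ℝ :=
  Real.sqrt |lor x x|

/-- A p-similarity: `f x = μ A x + b` with `μ ≠ 0`, `A` pseudo-orthogonal and `det A = 1`. -/
def IsPSimilarity {n : ℕ} (f : (Fin n → ℝ) → (Fin n → ℝ)) : Prop :=
  ∃ (μ : ℝ) (A : Matrix (Fin n) (Fin n) ℝ) (b : Fin n → ℝ),
    μ ≠ 0 ∧ A.transpose * metric n * A = metric n ∧ A.det = 1 ∧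
      ∀ x, f x = μ • A.mulVec x + b

/-- The derivative of a vector field `X` along the curve `α` with respect to the arc length `s`
of `α`, that is `d/ds = ‖dα/dt‖⁻¹ d/dt`. -/
noncomputable def arcDeriv {n : ℕ} (α X : ℝ → Fin n → ℝ) (t : ℝ) : Fin n → ℝ :=
  (lnorm (deriv α t))⁻¹ • deriv X t

/-- The curvature `κ_i = (d e_i / ds) ⬝ e_{i+1}`, for `1 ≤ i ≤ n - 1`. -/
noncomputable def curvature {n : ℕ} (α : ℝ → Fin n → ℝ) (e : ℕ → ℝ → Fin n → ℝ)
    (i : ℕ) (t : ℝ) : ℝ :=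
  lor (arcDeriv α (e i) t) (e (i + 1) t)

/-- On `I`, `α` is a non-null curve of class `C^n` with Frenet frame `e 1, …, e n`; the vector
`e i` is timelike if `ε i = -1` and spacelike if `ε i = 1`. -/
structure IsFrenetCurve {n : ℕ} (I : Set ℝ) (α : ℝ → Fin n → ℝ) (e : ℕ → ℝ → Fin n → ℝ)
    (ε : ℕ → ℝ) : Prop where
  contDiff : ContDiffOn ℝ n α I
  nonNull : ∀ t ∈ I, lor (deriv α t) (deriv α t) ≠ 0
  tangent : ∀ t ∈ I, deriv α t = lnorm (deriv α t) • e 1 t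
  differentiable : ∀ i ∈ Set.Icc 1 n, ∀ t ∈ I, DifferentiableAt ℝ (e i) t
  sign : ∀ i ∈ Set.Icc 1 n, ε i = 1 ∨ ε i = -1
  norm_self : ∀ i ∈ Set.Icc 1 n, ∀ t ∈ I, lor (e i t) (e i t) = ε i
  orthogonal : ∀ i ∈ Set.Icc 1 n, ∀ j ∈ Set.Icc 1 n, i ≠ j → ∀ t ∈ I, lor (e i t) (e j t) = 0
  curvature_pos : ∀ i, 1 ≤ i → i + 2 ≤ n → ∀ t ∈ I, 0 < curvature α e i t
  curvature_last : ∀ t ∈ I, curvature α e (n - 1) t ≠ 0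
  frenet_first : ∀ t ∈ I, arcDeriv α (e 1) t = (ε 2 * curvature α e 1 t) • e 2 t
  frenet_mid : ∀ i, 2 ≤ i → i + 1 ≤ n → ∀ t ∈ I, arcDeriv α (e i) t =
    (-ε (i - 1) * curvature α e (i - 1) t) • e (i - 1) t
      + (ε (i + 1) * curvature α e i t) • e (i + 1) t
  frenet_last : ∀ t ∈ I, arcDeriv α (e n) t =
    (-ε (n - 1) * curvature α e (n - 1) t) • e (n - 1) t

/-- The parameter is a spherical arc length parameter: an arc length parameter of the spherical
tangent indicatrix `e 1`. -/
def IsSphericalArcLength {n : ℕ} (I : Set ℝ) (e : ℕ → ℝ → Fin n → ℝ) : Prop :=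
  ∀ σ ∈ I, lnorm (deriv (e 1) σ) = 1

/-- The p-shape curvatures of a curve parametrized by spherical arc length:
`κ̃_1 = -(1 / κ_1) dκ_1/dσ` and `κ̃_i = κ_i / κ_1` for `2 ≤ i ≤ n - 1`. -/
noncomputable def pShape {n : ℕ} (α : ℝ → Fin n → ℝ) (e : ℕ → ℝ → Fin n → ℝ)
    (i : ℕ) (σ : ℝ) : ℝ :=
  if i = 1 then -(1 / curvature α e 1 σ) * deriv (curvature α e 1) σ
  else curvature α e i σ / curvature α e 1 σ

/-- The curve is self-similar with p-shape curvatures `κ 1, …, κ (n - 1)`: on `I` its p-shape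
curvatures are these constants. -/
def IsSelfSimilarWith {n : ℕ} (I : Set ℝ) (α : ℝ → Fin n → ℝ) (e : ℕ → ℝ → Fin n → ℝ)
    (κ : ℕ → ℝ) : Prop :=
  ∀ i, 1 ≤ i → i + 1 ≤ n → ∀ σ ∈ I, pShape α e i σ = κ i

/-- The constant tridiagonal matrix `M` with `de/dσ = M e`. In terms of indices counted from `1`:
`M_{i,i+1} = ε_{i+1} m_i` and `M_{i+1,i} = -ε_i m_i`, where `m_1 = 1` and `m_i = κ_i` for
`2 ≤ i ≤ n - 1`. -/
def frameMatrix (n : ℕ) (ε κ : ℕ → ℝ) : Matrix (Fin n) (Fin n) ℝ :=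
  let m : ℕ → ℝ := fun i => if i = 1 then 1 else κ i
  Matrix.of fun p q =>
    let i : ℕ := p + 1
    let j : ℕ := q + 1
    if j = i + 1 then ε j * m i
    else if i = j + 1 then -ε j * m j
    else 0

/-- The eigenvalue of `M²` that belongs to `lam i`: `lam 1 ^ 2` for the hyperbolic block, and
`-lam i ^ 2` for the rotation blocks `i ≥ 2`. -/
def sqEigenvalue (lam : ℕ → ℝ) (i : ℕ) : ℝ :=
  if i = 1 then lam i ^ 2 else -lam i ^ 2

/-- `b_1 = √(λ_1² - κ̃_1²)` and `b_i = √(λ_i² + κ̃_1²)` for `i ≥ 2`; here `c` is `κ̃_1`. -/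
noncomputable def bCoeff (c : ℝ) (lam : ℕ → ℝ) (i : ℕ) : ℝ :=
  if i = 1 then Real.sqrt (lam 1 ^ 2 - c ^ 2) else Real.sqrt (lam i ^ 2 + c ^ 2)

/-- `θ_1 = λ_1 σ - arcosh (λ_1 / b_1)` and `θ_i = λ_i σ + arccos (λ_i / b_i)` for `i ≥ 2`. -/
noncomputable def phase (c : ℝ) (lam : ℕ → ℝ) (i : ℕ) (σ : ℝ) : ℝ :=
  if i = 1 then lam 1 * σ - Real.arcosh (lam 1 / bCoeff c lam 1)
  else lam i * σ + Real.arccos (lam i / bCoeff c lam i)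

/-- The timelike curve
`((a_1/b_1) e^{cσ} sinh θ_1, (a_1/b_1) e^{cσ} cosh θ_1,`
` (a_2/b_2) e^{cσ} sin θ_2, -(a_2/b_2) e^{cσ} cos θ_2, …,`
` (a_k/b_k) e^{cσ} sin θ_k, -(a_k/b_k) e^{cσ} cos θ_k, a_{k+1} e^{cσ})`. -/
noncomputable def timelikeModel (k : ℕ) (c : ℝ) (lam a : ℕ → ℝ) (σ : ℝ) :
    Fin (2 * k + 1) → ℝ := fun j =>
  let i : ℕ := j / 2 + 1
  let r : ℝ := a i / bCoeff c lam i * Real.exp (c * σ)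
  let θ : ℝ := phase c lam i σ
  if (j : ℕ) = 2 * k then a (k + 1) * Real.exp (c * σ)
  else if (j : ℕ) = 0 then r * Real.sinh θ
  else if (j : ℕ) = 1 then r * Real.cosh θ
  else if Even (j : ℕ) then r * Real.sin θ
  else -r * Real.cos θ

/-- The spacelike curve
`(-(a_1/b_1) e^{cσ} cosh θ_1, -(a_1/b_1) e^{cσ} sinh θ_1,`
` (a_2/b_2) e^{cσ} sin θ_2, -(a_2/b_2) e^{cσ} cos θ_2, …,`
` (a_k/b_k) e^{cσ} sin θ_k, -(a_k/b_k) e^{cσ} cos θ_k, a_{k+1} e^{cσ})`. -/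
noncomputable def spacelikeModel (k : ℕ) (c : ℝ) (lam a : ℕ → ℝ) (σ : ℝ) :
    Fin (2 * k + 1) → ℝ := fun j =>
  let i : ℕ := j / 2 + 1
  let r : ℝ := a i / bCoeff c lam i * Real.exp (c * σ)
  let θ : ℝ := phase c lam i σ
  if (j : ℕ) = 2 * k then a (k + 1) * Real.exp (c * σ)
  else if (j : ℕ) = 0 then -r * Real.cosh θ
  else if (j : ℕ) = 1 then -r * Real.sinh θ
  else if Even (j : ℕ) then r * Real.sin θ
  else -r * Real.cos θ

/-- The vectors determined by a curve `β` in the timelike case (index `0` is unused):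
`e_1 = e^{-κ_1 σ} β'`, `e_2 = e_1'`, `e_3 = (1/κ_2) (-e_1 + e_2')` and
`e_{i+1} = (1/κ_i) (κ_{i-1} e_{i-1} + e_i')` for `i ≥ 3`. -/
noncomputable def timelikeFrame {n : ℕ} (κ : ℕ → ℝ) (β : ℝ → Fin n → ℝ) :
    ℕ → ℝ → Fin n → ℝ
  | 0 => 0
  | 1 => fun σ => Real.exp (-(κ 1 * σ)) • deriv β σ
  | 2 => fun σ => deriv (timelikeFrame κ β 1) σ
  | 3 => fun σ => (1 / κ 2) • (-timelikeFrame κ β 1 σ + deriv (timelikeFrame κ β 2) σ)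
  | i + 4 => fun σ => (1 / κ (i + 3)) •
      (κ (i + 2) • timelikeFrame κ β (i + 2) σ + deriv (timelikeFrame κ β (i + 3)) σ)

/-- The vectors determined by a curve `β` in the spacelike case (index `0` is unused):
`e_1 = e^{-κ_1 σ} β'`, `e_2 = -e_1'`, `e_3 = (1/κ_2) (e_1 + e_2')`,
`e_4 = (1/κ_3) (-κ_2 e_2 + e_3')` and
`e_{i+1} = (1/κ_i) (κ_{i-1} e_{i-1} + e_i')` for `i ≥ 4`. -/
noncomputable def spacelikeFrame {n : ℕ} (κ : ℕ → ℝ) (β : ℝ → Fin n → ℝ) :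
    ℕ → ℝ → Fin n → ℝ
  | 0 => 0
  | 1 => fun σ => Real.exp (-(κ 1 * σ)) • deriv β σ
  | 2 => fun σ => -deriv (spacelikeFrame κ β 1) σ
  | 3 => fun σ => (1 / κ 2) • (spacelikeFrame κ β 1 σ + deriv (spacelikeFrame κ β 2) σ)
  | 4 => fun σ => (1 / κ 3) •
      (-κ 2 • spacelikeFrame κ β 2 σ + deriv (spacelikeFrame κ β 3) σ)
  | i + 5 => fun σ => (1 / κ (i + 4)) •
      (κ (i + 3) • spacelikeFrame κ β (i + 3) σ + deriv (spacelikeFrame κ β (i + 4)) σ)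

end Minkowski

namespace Minkowski

/-! In the parameter `σ` the Frenet equations become the linear system `e' = M e` with constant `M`,
so the theorem reduces to solving this system explicitly and proving uniqueness up to p-similarity.

Solving. Since `M` is tridiagonal with zero diagonal, a coordinate `x` of `e 1` with `x'' = t x`
determines the same coordinate of every `e i`: it is a number `framePoly ε m t i` times `x` or `x'`,
according to the parity of `i`. The last Frenet equation then imposes one condition on `t`
(`IsNode`), which every nonzero eigenvalue of `M²` satisfies (`isNode_of_hasEigenvalue`). The `k`
given eigenvalues supply two coordinates each, hyperbolic for `lam 1 ^ 2` and trigonometric for the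
others; the kernel of `M` (`t = 0`) supplies the last, constant one.

Normalizing. `M` is skew for `diag ε`, so the vectors belonging to different `t` are orthogonal, and
the squared length of an odd vector is `-t` times that of the even one. The frame is therefore
pseudo-orthonormal once each block of `e 1` has the reciprocal of the squared length of its odd
vector as squared length (`blockFrame_gram`). Real nonzero `a i` achieving this exist because the
causal character of `e 1` or `e 2` forces the right signs (`squared_length_of_timelike_fst`,
`frameForm_oddVec_pos`). The quadratic system says that rows of this frame have squared length `ε
i`.

Uniqueness. If the matrices `E`, `F` both solve the system, then `Fᵀ (diag ε) E` is constant, so a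
constant pseudo-orthogonal matrix carries one frame to the other. Because `κ_1` is a constant times
`e^{-κ̃_1 σ}`, integrating `e 1` gives a p-similarity of the curves (`exists_isPSimilarity`). -/

/-! ### The three-term recursion of the Frenet equations -/

/-- The coefficients `m_1 = 1` and `m_i = κ_i` for `i ≥ 2` of `frameMatrix`. -/
def shapeCoeff (κ : ℕ → ℝ) (i : ℕ) : ℝ := if i = 1 then 1 else κ i

lemma shapeCoeff_ne_zero {κ : ℕ → ℝ} {i : ℕ} (h : κ i ≠ 0) : shapeCoeff κ i ≠ 0 := by
  unfold shapeCoeff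
  split_ifs <;> simp [h]

/-- The solution of the three-term recursion of `frameMatrix`: if `e 1` is a function `x` with
`x'' = t x`, then `e i` is `framePoly ε m t i` times `x` (`i` odd) or `x'` (`i` even). -/
noncomputable def framePoly (ε m : ℕ → ℝ) (t : ℝ) : ℕ → ℝ
  | 0 => 0
  | 1 => 1
  | i + 2 => ε (i + 2) / m (i + 1) *
      ((if Even (i + 1) then t else 1) * framePoly ε m t (i + 1) + ε i * m i * framePoly ε m t i)

lemma framePoly_rec {ε m : ℕ → ℝ} (t : ℝ) {i : ℕ} (hε : ε (i + 2) = 1 ∨ ε (i + 2) = -1)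
    (hm : m (i + 1) ≠ 0) :
    (if Even (i + 1) then t else 1) * framePoly ε m t (i + 1) =
      -ε i * m i * framePoly ε m t i + ε (i + 2) * m (i + 1) * framePoly ε m t (i + 2) := by
  have h : ε (i + 2) * ε (i + 2) = 1 := by rcases hε with h | h <;> rw [h] <;> norm_num
  rw [framePoly.eq_3]
  generalize (if Even (i + 1) then t else 1) * framePoly ε m t (i + 1) = X
  generalize framePoly ε m t i = Y
  field_simp
  linear_combination (-(X + Y * ε i * m i)) * h

/-- Padding by zero at the indices `0` and `n + 1` gives the first and last rows the same form as
the middle ones. -/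
lemma frameMatrix_mulVec {n : ℕ} (ε κ g : ℕ → ℝ) (h0 : g 0 = 0) (hn : g (n + 1) = 0)
    (p : Fin n) :
    (frameMatrix n ε κ).mulVec (fun q => g (q + 1)) p =
      -ε p * shapeCoeff κ p * g p + ε (p + 2) * shapeCoeff κ (p + 1) * g (p + 2) := by
  -- For `p = 0` the truncated `p - 1` equals `0` and selects a spurious term, which vanishes
  -- because `g 0 = 0`.
  have key : ∀ q : ℕ, (if q + 1 = (p : ℕ) + 1 + 1 then ε (q + 1) * shapeCoeff κ (p + 1)
      else if (p : ℕ) + 1 = q + 1 + 1 then -ε (q + 1) * shapeCoeff κ (q + 1) else 0) * g (q + 1) =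
      (if (p : ℕ) + 1 = q then ε (p + 2) * shapeCoeff κ (p + 1) * g (p + 2) else 0) +
      (if (p : ℕ) - 1 = q then -ε p * shapeCoeff κ p * g p else 0) := by
    intro q
    rcases Nat.eq_zero_or_pos (p : ℕ) with hp | hp
    · simp only [hp, h0]
      by_cases h : q = 1 <;> grind
    · obtain ⟨r, hr⟩ : ∃ r, (p : ℕ) = r + 1 := ⟨p - 1, by omega⟩
      rw [hr]
      grind
  have hp := p.2
  calc (frameMatrix n ε κ).mulVec (fun q => g (q + 1)) p
      = ∑ q : Fin n, (if (q : ℕ) + 1 = (p : ℕ) + 1 + 1 then ε (q + 1) * shapeCoeff κ (p + 1)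
        else if (p : ℕ) + 1 = q + 1 + 1 then -ε (q + 1) * shapeCoeff κ (q + 1) else 0) *
          g (q + 1) := rfl
    _ = _ := by
      simp only [key]
      rw [Fin.sum_univ_eq_sum_range (fun q : ℕ =>
        (if (p : ℕ) + 1 = q then ε (p + 2) * shapeCoeff κ (p + 1) * g (p + 2) else 0) +
        (if (p : ℕ) - 1 = q then -ε p * shapeCoeff κ p * g p else 0)) n, Finset.sum_add_distrib,
        Finset.sum_ite_eq, Finset.sum_ite_eq,
        if_pos (Finset.mem_range.2 (show (p : ℕ) - 1 < n by omega)), add_comm]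
      congr 1
      split_ifs with h
      · rfl
      · rw [Finset.mem_range] at h
        rw [show (p : ℕ) + 2 = n + 1 by omega, hn, mul_zero]

/-! ### Skewness of the frame matrix for `diag ε` -/

/-- The bilinear form `diag (ε 1, …, ε n)`. -/
def frameForm {n : ℕ} (ε : ℕ → ℝ) (u v : Fin n → ℝ) : ℝ :=
  ∑ p : Fin n, ε (p + 1) * u p * v p

lemma frameForm_comm {n : ℕ} (ε : ℕ → ℝ) (u v : Fin n → ℝ) :
    frameForm ε u v = frameForm ε v u :=
  Finset.sum_congr rfl fun _ _ => by ring

lemma frameForm_smul_left {n : ℕ} (ε : ℕ → ℝ) (r : ℝ) (u v : Fin n → ℝ) :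
    frameForm ε (r • u) v = r * frameForm ε u v := by
  simp only [frameForm, Finset.mul_sum, Pi.smul_apply, smul_eq_mul]
  exact Finset.sum_congr rfl fun _ _ => by ring

lemma sign_mul_frameMatrix {n : ℕ} {ε κ : ℕ → ℝ} (hε : ∀ i ∈ Set.Icc 1 n, ε i = 1 ∨ ε i = -1)
    (p q : Fin n) :
    ε (p + 1) * frameMatrix n ε κ p q = -(ε (q + 1) * frameMatrix n ε κ q p) := by
  have h1 : ∀ r : Fin n, ε (r + 1) * ε (r + 1) = 1 := fun r => by
    rcases hε (r + 1) ⟨by omega, by omega⟩ with h | h <;> rw [h] <;> norm_num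
  have hp := h1 p
  have hq := h1 q
  simp only [frameMatrix, Matrix.of_apply]
  split_ifs <;> first | omega | grind

lemma frameForm_mulVec {n : ℕ} {ε κ : ℕ → ℝ} (hε : ∀ i ∈ Set.Icc 1 n, ε i = 1 ∨ ε i = -1)
    (u v : Fin n → ℝ) :
    frameForm ε ((frameMatrix n ε κ).mulVec u) v =
      -frameForm ε u ((frameMatrix n ε κ).mulVec v) := by
  simp only [frameForm, Matrix.mulVec, dotProduct, Finset.mul_sum, Finset.sum_mul]
  rw [Finset.sum_comm, ← Finset.sum_neg_distrib]
  refine Finset.sum_congr rfl fun q _ => ?_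
  rw [← Finset.sum_neg_distrib]
  refine Finset.sum_congr rfl fun p _ => ?_
  linear_combination u q * v p * sign_mul_frameMatrix (κ := κ) hε p q

/-! ### Odd and even vectors: the frame matrix exchanges them -/

/-- The odd part of `framePoly` as a vector. -/
noncomputable def oddVec (n : ℕ) (ε κ : ℕ → ℝ) (t : ℝ) : Fin n → ℝ := fun p =>
  if Even ((p : ℕ) + 1) then 0 else framePoly ε (shapeCoeff κ) t (p + 1)

/-- The even part of `framePoly` as a vector. -/
noncomputable def evenVec (n : ℕ) (ε κ : ℕ → ℝ) (t : ℝ) : Fin n → ℝ := fun p =>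
  if Even ((p : ℕ) + 1) then framePoly ε (shapeCoeff κ) t (p + 1) else 0

/-- The condition on `t` for `framePoly` to satisfy the last row of the recursion. -/
def IsNode (k : ℕ) (ε κ : ℕ → ℝ) (t : ℝ) : Prop :=
  framePoly ε (shapeCoeff κ) t (2 * k + 1) +
    ε (2 * k) * shapeCoeff κ (2 * k) * framePoly ε (shapeCoeff κ) t (2 * k) = 0

section

variable {k : ℕ} {ε κ : ℕ → ℝ} (hε : ∀ i ∈ Set.Icc 1 (2 * k + 1), ε i = 1 ∨ ε i = -1)
  (hκ : ∀ i ∈ Set.Icc 1 (2 * k), κ i ≠ 0)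

include hε hκ

lemma framePoly_rec' (t : ℝ) {i : ℕ} (hi : i + 2 ≤ 2 * k + 1) :
    (if Even (i + 1) then t else 1) * framePoly ε (shapeCoeff κ) t (i + 1) =
      -ε i * shapeCoeff κ i * framePoly ε (shapeCoeff κ) t i +
        ε (i + 2) * shapeCoeff κ (i + 1) * framePoly ε (shapeCoeff κ) t (i + 2) :=
  framePoly_rec t (hε _ ⟨by omega, hi⟩) (shapeCoeff_ne_zero (hκ _ ⟨by omega, by omega⟩))

/-- No condition on `t` is needed: the image lives in the even rows, all of which are covered by the
recursion, as the last row `2 k + 1` is odd. -/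
lemma mulVec_oddVec (t : ℝ) :
    (frameMatrix (2 * k + 1) ε κ).mulVec (oddVec (2 * k + 1) ε κ t) =
      t • evenVec (2 * k + 1) ε κ t := by
  ext p
  have hp := p.2
  have h := frameMatrix_mulVec (n := 2 * k + 1) ε κ
    (fun i => if Even i then 0 else framePoly ε (shapeCoeff κ) t i) (by simp)
    (by simp [Nat.even_add_one]) p
  refine Eq.trans h ?_
  simp only [evenVec, Pi.smul_apply, smul_eq_mul]
  by_cases he : Even ((p : ℕ) + 1)
  · have hr := framePoly_rec' hε hκ t (i := p) (by grind)
    have h1 : ¬ Even (p : ℕ) := by grind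
    have h2 : ¬ Even ((p : ℕ) + 2) := by grind
    rw [if_pos he] at hr
    rw [if_neg h1, if_neg h2, if_pos he, hr]
  · have h1 : Even (p : ℕ) := by grind
    have h2 : Even ((p : ℕ) + 2) := by grind
    rw [if_pos h1, if_pos h2, if_neg he]
    ring

/-- Here the last row is involved. The recursion does not cover it; it is exactly `IsNode`. -/
lemma mulVec_evenVec {t : ℝ} (ht : IsNode k ε κ t) :
    (frameMatrix (2 * k + 1) ε κ).mulVec (evenVec (2 * k + 1) ε κ t) =
      oddVec (2 * k + 1) ε κ t := by
  ext p
  have hp := p.2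
  have h := frameMatrix_mulVec (n := 2 * k + 1) ε κ
    (fun i => if Even i ∧ i ≤ 2 * k + 1 then framePoly ε (shapeCoeff κ) t i else 0)
    (by simp [framePoly]) (by simp) p
  have h' : evenVec (2 * k + 1) ε κ t = fun q : Fin (2 * k + 1) =>
      if Even ((q : ℕ) + 1) ∧ (q : ℕ) + 1 ≤ 2 * k + 1 then
        framePoly ε (shapeCoeff κ) t (q + 1) else 0 := by
    ext q
    have hq := q.2
    simp only [evenVec]
    congr 1
    exact propext ⟨fun h => ⟨h, by omega⟩, fun h => h.1⟩
  rw [h']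
  refine Eq.trans h ?_
  simp only [oddVec]
  by_cases he : Even ((p : ℕ) + 1)
  · have h1 : ¬ Even (p : ℕ) := by grind
    have h2 : ¬ Even ((p : ℕ) + 2) := by grind
    simp [h1, h2, he]
  · have h1 : Even (p : ℕ) := by grind
    have h2 : Even ((p : ℕ) + 2) := by grind
    rw [if_pos ⟨h1, by omega⟩, if_neg he]
    by_cases hl : (p : ℕ) + 2 ≤ 2 * k + 1
    · have hr := framePoly_rec' hε hκ t (i := p) hl
      rw [if_neg he, one_mul] at hr
      rw [if_pos ⟨h2, hl⟩, hr]
    · rw [if_neg (fun h => hl h.2)]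
      have h3 : (p : ℕ) = 2 * k := by omega
      unfold IsNode at ht
      rw [h3]
      linear_combination -ht

/-- With `u = M v` and `M u = t v`, the recursion expresses all entries of `v` and `u` through `v_1`
and `u_1`. The last rows then read `δ u_1 = 0` and `t δ v_1 = 0`, where `δ` is the quantity that
`IsNode` asks to vanish. If `δ ≠ 0`, then `u_1 = v_1 = 0`, which forces `v = 0`. -/
lemma isNode_of_hasEigenvalue {t : ℝ} (ht : t ≠ 0)
    (h : Module.End.HasEigenvalue (Matrix.toLin' (frameMatrix (2 * k + 1) ε κ ^ 2)) t) :
    IsNode k ε κ t := by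
  obtain ⟨v, hv⟩ := h.exists_hasEigenvector
  have hv0 := hv.2
  have hvt := hv.apply_eq_smul
  rw [Matrix.toLin'_apply, pow_two, ← Matrix.mulVec_mulVec] at hvt
  set u := (frameMatrix (2 * k + 1) ε κ).mulVec v with hu
  -- Vectors are reindexed from `1` and padded by zero, so that the rows obey one formula.
  let ext : (Fin (2 * k + 1) → ℝ) → ℕ → ℝ := fun w i =>
    if h : 1 ≤ i ∧ i ≤ 2 * k + 1 then w ⟨i - 1, by omega⟩ else 0
  have ext_fun : ∀ w, w = fun q : Fin (2 * k + 1) => ext w (q + 1) := by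
    intro w
    ext q
    have hq := q.2
    simp only [ext]
    rw [dif_pos ⟨by omega, by omega⟩]
    rfl
  have row : ∀ w, ∀ i, i + 1 ≤ 2 * k + 1 →
      ext ((frameMatrix (2 * k + 1) ε κ).mulVec w) (i + 1) =
        -ε i * shapeCoeff κ i * ext w i + ε (i + 2) * shapeCoeff κ (i + 1) * ext w (i + 2) := by
    intro w i hi
    have h := frameMatrix_mulVec (n := 2 * k + 1) ε κ (ext w) (by simp [ext]) (by simp [ext])
      ⟨i, by omega⟩
    rw [← ext_fun w] at h
    rw [← h]
    simp only [ext]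
    rw [dif_pos ⟨by omega, by omega⟩]
    rfl
  have rowv : ∀ i, i + 1 ≤ 2 * k + 1 → ext u (i + 1) =
      -ε i * shapeCoeff κ i * ext v i + ε (i + 2) * shapeCoeff κ (i + 1) * ext v (i + 2) :=
    row v
  have rowu : ∀ i, i + 1 ≤ 2 * k + 1 → t * ext v (i + 1) =
      -ε i * shapeCoeff κ i * ext u i + ε (i + 2) * shapeCoeff κ (i + 1) * ext u (i + 2) := by
    intro i hi
    rw [← row u i hi, hvt]
    simp only [ext]
    rw [dif_pos ⟨by omega, by omega⟩, dif_pos ⟨by omega, by omega⟩]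
    rfl
  set q := framePoly ε (shapeCoeff κ) t with hq
  have sol : ∀ i, i ≤ 2 * k + 1 →
      (Even i → ext v i = q i * ext u 1 ∧ ext u i = t * q i * ext v 1) ∧
      (¬ Even i → ext v i = q i * ext v 1 ∧ ext u i = q i * ext u 1) := by
    intro i
    induction i using Nat.twoStepInduction with
    | zero => simp [ext, hq, framePoly]
    | one => simp [hq, framePoly]
    | more i ih1 ih2 =>
      intro hi
      have ih1 := ih1 (by omega)
      have ih2 := ih2 (by omega)
      have hc : ε (i + 2) * shapeCoeff κ (i + 1) ≠ 0 := by
        refine mul_ne_zero ?_ (shapeCoeff_ne_zero (hκ _ ⟨by omega, by omega⟩))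
        rcases hε (i + 2) ⟨by omega, hi⟩ with h | h <;> rw [h] <;> norm_num
      have r1 := rowv i (by omega)
      have r2 := rowu i (by omega)
      have r3 := framePoly_rec' hε hκ t (i := i) hi
      rw [← hq] at r3
      by_cases he : Even i
      · have he1 : ¬ Even (i + 1) := by grind
        have he2 : Even (i + 2) := by grind
        obtain ⟨a1, a2⟩ := ih1.1 he
        obtain ⟨b1, b2⟩ := ih2.2 he1
        rw [if_neg he1] at r3
        refine ⟨fun _ => ⟨mul_left_cancel₀ hc ?_, mul_left_cancel₀ hc ?_⟩, fun h => absurd he2 h⟩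
        · rw [a1, b2] at r1
          linear_combination -r1 + ext u 1 * r3
        · rw [a2, b1] at r2
          linear_combination -r2 + t * ext v 1 * r3
      · have he1 : Even (i + 1) := by grind
        have he2 : ¬ Even (i + 2) := by grind
        obtain ⟨a1, a2⟩ := ih1.2 he
        obtain ⟨b1, b2⟩ := ih2.1 he1
        rw [if_pos he1] at r3
        refine ⟨fun h => absurd h he2, fun _ => ⟨mul_left_cancel₀ hc ?_, mul_left_cancel₀ hc ?_⟩⟩
        · rw [a1, b2] at r1
          linear_combination -r1 + ext v 1 * r3
        · rw [a2, b1] at r2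
          linear_combination -r2 + ext u 1 * r3
  have hodd : ¬ Even (2 * k + 1) := by grind
  have r1 := rowv (2 * k) le_rfl
  have r2 := rowu (2 * k) le_rfl
  have e2 : ∀ w, ext w (2 * k + 2) = 0 := fun w => by simp [ext]
  obtain ⟨a1, a2⟩ := (sol (2 * k) (by omega)).1 (even_two_mul k)
  obtain ⟨b1, b2⟩ := (sol (2 * k + 1) le_rfl).2 hodd
  rw [e2, a1, b2] at r1
  rw [e2, a2, b1] at r2
  unfold IsNode
  rw [← hq]
  by_contra hne
  have hu1 : ext u 1 = 0 := by
    refine (mul_eq_zero.1 ?_).resolve_left hne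
    linear_combination r1
  have hv1 : ext v 1 = 0 := by
    refine (mul_eq_zero.1 ?_).resolve_left (mul_ne_zero ht hne)
    linear_combination r2
  refine hv0 ?_
  rw [ext_fun v]
  ext p
  have hp := p.2
  have := sol (p + 1) (by omega)
  by_cases he : Even ((p : ℕ) + 1)
  · simp [(this.1 he).1, hu1]
  · simp [(this.2 he).1, hv1]

/-- Skewness applied to `M odd(t) = t even(t)` and `M even(s) = odd(s)`. Only `s` has to be a node,
so `t = 0` is allowed. -/
lemma frameForm_oddVec (t : ℝ) {s : ℝ} (hs : IsNode k ε κ s) :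
    frameForm ε (oddVec (2 * k + 1) ε κ t) (oddVec (2 * k + 1) ε κ s) =
      -t * frameForm ε (evenVec (2 * k + 1) ε κ t) (evenVec (2 * k + 1) ε κ s) := by
  have h := frameForm_mulVec (κ := κ) hε (oddVec (2 * k + 1) ε κ t) (evenVec (2 * k + 1) ε κ s)
  rw [mulVec_evenVec hε hκ hs, mulVec_oddVec hε hκ, frameForm_smul_left] at h
  linarith

/-- By symmetry of the form, `frameForm_oddVec` holds with the factor `-t` and with the factor `-s`.
-/
lemma frameForm_evenVec_eq_zero {t s : ℝ} (ht : IsNode k ε κ t) (hs : IsNode k ε κ s)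
    (hts : t ≠ s) :
    frameForm ε (evenVec (2 * k + 1) ε κ t) (evenVec (2 * k + 1) ε κ s) = 0 := by
  have h1 := frameForm_oddVec hε hκ t hs
  have h2 := frameForm_oddVec hε hκ s ht
  rw [frameForm_comm, frameForm_comm ε (evenVec _ _ _ s)] at h2
  have : (t - s) * frameForm ε (evenVec (2 * k + 1) ε κ t) (evenVec (2 * k + 1) ε κ s) = 0 := by
    linear_combination h1 - h2
  exact (mul_eq_zero.1 this).resolve_left (sub_ne_zero.2 hts)

end

lemma frameForm_oddVec_evenVec {n : ℕ} (ε κ : ℕ → ℝ) (t s : ℝ) :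
    frameForm ε (oddVec n ε κ t) (evenVec n ε κ s) = 0 := by
  refine Finset.sum_eq_zero fun p _ => ?_
  simp only [oddVec, evenVec]
  split_ifs <;> simp


/-! ### The Lorentzian product in coordinates -/

lemma lor_eq_sum {n : ℕ} (x y : Fin n → ℝ) :
    lor x y = ∑ j : Fin n, (if (j : ℕ) = 0 then -1 else 1) * x j * y j := by
  simp only [lor, metric, dotProduct, Matrix.mulVec_diagonal]
  exact Finset.sum_congr rfl fun _ _ => by ring

lemma lor_nonneg_of_zero {n : ℕ} {x : Fin n → ℝ} (h : ∀ j : Fin n, (j : ℕ) = 0 → x j = 0) :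
    0 ≤ lor x x := by
  rw [lor_eq_sum]
  refine Finset.sum_nonneg fun j _ => ?_
  by_cases hj : (j : ℕ) = 0
  · simp [h j hj]
  · rw [if_neg hj, one_mul]
    exact mul_self_nonneg _

lemma lor_combination {n : ℕ} (x y : Fin n → ℝ) (a b : ℝ) :
    lor (a • x + b • y) (a • x + b • y) =
      a ^ 2 * lor x x + 2 * (a * b) * lor x y + b ^ 2 * lor y y := by
  simp only [lor_eq_sum, Finset.mul_sum, ← Finset.sum_add_distrib, Pi.add_apply, Pi.smul_apply,
    smul_eq_mul]
  exact Finset.sum_congr rfl fun _ _ => by ring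

/-- The combination of `x` and `y` that kills the time coordinate has nonnegative square. Expanded
with `x ⬝ y = 0`, this rules out that both squares are negative. Hence a frame has at most one
timelike vector. -/
lemma not_timelike_of_orthogonal {n : ℕ} {x y : Fin n → ℝ} (hx : lor x x < 0) (hxy : lor x y = 0) :
    0 ≤ lor y y := by
  rcases Nat.eq_zero_or_pos n with rfl | hn
  · simp [lor_eq_sum]
  have h := lor_nonneg_of_zero (x := y ⟨0, hn⟩ • x + (-x ⟨0, hn⟩) • y) (by
    intro j hj
    obtain rfl : j = ⟨0, hn⟩ := Fin.ext hj
    simp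
    ring)
  rw [lor_combination, hxy] at h
  have hx0 : x ⟨0, hn⟩ ≠ 0 := by
    intro h0
    refine absurd (lor_nonneg_of_zero (x := x) ?_) (not_le.2 hx)
    intro j hj
    obtain rfl : j = ⟨0, hn⟩ := Fin.ext hj
    exact h0
  have h1 : 0 < x ⟨0, hn⟩ ^ 2 := by positivity
  have h2 : 0 ≤ y ⟨0, hn⟩ ^ 2 := by positivity
  by_contra! hneg
  nlinarith [mul_neg_of_pos_of_neg h1 hneg, mul_nonpos_of_nonneg_of_nonpos h2 hx.le]

lemma IsFrenetCurve.sign_eq_one {n : ℕ} {I : Set ℝ} {α : ℝ → Fin n → ℝ} {e : ℕ → ℝ → Fin n → ℝ}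
    {ε : ℕ → ℝ} (hα : IsFrenetCurve I α e ε) (hne : I.Nonempty) {i j : ℕ} (hi : i ∈ Set.Icc 1 n)
    (hj : j ∈ Set.Icc 1 n) (hij : i ≠ j) (h : ε i = -1) : ε j = 1 := by
  obtain ⟨t, ht⟩ := hne
  have h1 := hα.norm_self i hi t ht
  have h2 := hα.norm_self j hj t ht
  have h3 := not_timelike_of_orthogonal (x := e i t) (y := e j t) (by rw [h1, h]; norm_num)
    (hα.orthogonal i hi j hj hij t ht)
  rcases hα.sign j hj with h4 | h4
  · exact h4
  · rw [h2, h4] at h3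
    norm_num at h3

/-! ### Signs of the squared lengths of the odd vectors -/

lemma oddVec_zero {k : ℕ} (ε κ : ℕ → ℝ) (t : ℝ) : oddVec (2 * k + 1) ε κ t 0 = 1 := by
  simp [oddVec, framePoly]

lemma frameForm_self_pos {n : ℕ} {ε : ℕ → ℝ} {u : Fin n → ℝ}
    (h : ∀ p : Fin n, u p ≠ 0 → ε (p + 1) = 1) (hu : ∃ p, u p ≠ 0) : 0 < frameForm ε u u := by
  obtain ⟨p, hp⟩ := hu
  refine Finset.sum_pos' (fun q _ => ?_) ⟨p, Finset.mem_univ _, ?_⟩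
  · by_cases hq : u q = 0
    · simp [hq]
    · rw [h q hq, one_mul]
      exact mul_self_nonneg _
  · rw [h p hp, one_mul]
    exact mul_self_pos.2 hp

lemma frameForm_oddVec_pos {k : ℕ} {ε : ℕ → ℝ} (κ : ℕ → ℝ)
    (hε : ∀ i ∈ Set.Icc 1 (2 * k + 1), i ≠ 2 → ε i = 1) (t : ℝ) :
    0 < frameForm ε (oddVec (2 * k + 1) ε κ t) (oddVec (2 * k + 1) ε κ t) := by
  refine frameForm_self_pos (fun p hp => hε _ ⟨by omega, by omega⟩ ?_)
    ⟨0, by rw [oddVec_zero]; norm_num⟩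
  intro h
  exact hp (if_pos (by rw [h]; decide))

lemma frameForm_evenVec_pos {k : ℕ} (hk : 1 ≤ k) {ε : ℕ → ℝ} (κ : ℕ → ℝ)
    (hε : ∀ i ∈ Set.Icc 1 (2 * k + 1), i ≠ 1 → ε i = 1) (t : ℝ) :
    0 < frameForm ε (evenVec (2 * k + 1) ε κ t) (evenVec (2 * k + 1) ε κ t) := by
  refine frameForm_self_pos (fun p hp => hε _ ⟨by omega, by omega⟩ ?_) ⟨⟨1, by omega⟩, ?_⟩
  · intro h
    exact hp (if_neg (by rw [h]; decide))
  · have h2 : ε 2 = 1 := hε 2 ⟨by omega, by omega⟩ (by norm_num)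
    simp [evenVec, framePoly, shapeCoeff, h2]

/-- Both odd vectors have first entry `1`, so their difference avoids the only negative direction
and has nonnegative square; orthogonality leaves the sum of the two squares. -/
lemma frameForm_oddVec_zero_pos {k : ℕ} {ε κ : ℕ → ℝ}
    (hε : ∀ i ∈ Set.Icc 1 (2 * k + 1), i ≠ 1 → ε i = 1) {t : ℝ}
    (ht : frameForm ε (oddVec (2 * k + 1) ε κ t) (oddVec (2 * k + 1) ε κ t) < 0)
    (h0 : frameForm ε (oddVec (2 * k + 1) ε κ 0) (oddVec (2 * k + 1) ε κ t) = 0) :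
    0 < frameForm ε (oddVec (2 * k + 1) ε κ 0) (oddVec (2 * k + 1) ε κ 0) := by
  set u := oddVec (2 * k + 1) ε κ 0
  set v := oddVec (2 * k + 1) ε κ t
  have h : 0 ≤ frameForm ε (u - v) (u - v) := by
    refine Finset.sum_nonneg fun p _ => ?_
    by_cases hp : (p : ℕ) = 0
    · obtain rfl : p = 0 := Fin.ext hp
      simp [u, v, oddVec_zero]
    · rw [hε _ ⟨by omega, by omega⟩ (by omega), one_mul]
      exact mul_self_nonneg _
  have h2 : frameForm ε (u - v) (u - v) =
      frameForm ε u u - 2 * frameForm ε u v + frameForm ε v v := by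
    simp only [frameForm, Finset.mul_sum, ← Finset.sum_sub_distrib, ← Finset.sum_add_distrib,
      Pi.sub_apply]
    exact Finset.sum_congr rfl fun _ _ => by ring
  rw [h2, h0] at h
  linarith

/-! ### Frames built from solutions of `x'' = t x` -/

/-- The sign `-1` of the first block and `1` of the others; blocks are counted from `1`. -/
def blockSign (l : ℕ) : ℝ := if l = 1 then -1 else 1

lemma sqEigenvalue_eq (lam : ℕ → ℝ) (l : ℕ) : sqEigenvalue lam l = -blockSign l * lam l ^ 2 := by
  unfold sqEigenvalue blockSign
  split_ifs <;> ring

lemma blockSign_mul_self (l : ℕ) : blockSign l * blockSign l = 1 := by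
  unfold blockSign
  split_ifs <;> norm_num

/-- The number `t` of block `l`: `sqEigenvalue lam l` for `l ≤ k`, and `0` for the last
coordinate. -/
def node (k : ℕ) (lam : ℕ → ℝ) (l : ℕ) : ℝ := if l = k + 1 then 0 else sqEigenvalue lam l

lemma node_of_lt {k l : ℕ} (lam : ℕ → ℝ) (hl : l < k) :
    node k lam (l + 1) = -blockSign (l + 1) * lam (l + 1) ^ 2 := by
  rw [node, if_neg (by omega), sqEigenvalue_eq]

lemma node_last (k : ℕ) (lam : ℕ → ℝ) : node k lam (k + 1) = 0 := if_pos rfl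

/-- The values `x j` and `y j` at one point of the coordinates of `e 1` and of their derivatives:
block `l` consists of the coordinates `2 l - 2` and `2 l - 1`, and its squared length is `w l`. -/
structure IsBlockValue (k : ℕ) (lam w x y : ℕ → ℝ) : Prop where
  fst : ∀ l < k, y (2 * l) = -blockSign (l + 1) * lam (l + 1) * x (2 * l + 1)
  snd : ∀ l < k, y (2 * l + 1) = lam (l + 1) * x (2 * l)
  last : y (2 * k) = 0
  norm : ∀ l < k, blockSign (l + 1) * x (2 * l) ^ 2 + x (2 * l + 1) ^ 2 = w (l + 1)
  norm_last : x (2 * k) ^ 2 = w (k + 1)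

/-- The matrix with rows `e 1, …, e n` that belongs to the values `x` of `e 1` and `y` of its
derivative. -/
noncomputable def blockFrame (k : ℕ) (ε κ lam x y : ℕ → ℝ) :
    Matrix (Fin (2 * k + 1)) (Fin (2 * k + 1)) ℝ := Matrix.of fun p j =>
  x j * oddVec (2 * k + 1) ε κ (node k lam (j / 2 + 1)) p +
    y j * evenVec (2 * k + 1) ε κ (node k lam (j / 2 + 1)) p

lemma metric_apply {n : ℕ} (i j : Fin n) :
    metric n i j = if i = j then (if (i : ℕ) = 0 then -1 else 1) else 0 := by
  simp [metric, Matrix.diagonal_apply]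

lemma frameForm_combination {n : ℕ} (ε κ : ℕ → ℝ) (t s x y x' y' : ℝ) :
    frameForm ε (fun p => x * oddVec n ε κ t p + y * evenVec n ε κ t p)
      (fun p => x' * oddVec n ε κ s p + y' * evenVec n ε κ s p) =
    x * x' * frameForm ε (oddVec n ε κ t) (oddVec n ε κ s) +
      y * y' * frameForm ε (evenVec n ε κ t) (evenVec n ε κ s) := by
  have h1 := frameForm_oddVec_evenVec (n := n) ε κ t s
  have h2 := frameForm_oddVec_evenVec (n := n) ε κ s t
  rw [frameForm_comm] at h2
  have : frameForm ε (fun p => x * oddVec n ε κ t p + y * evenVec n ε κ t p)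
      (fun p => x' * oddVec n ε κ s p + y' * evenVec n ε κ s p) =
    x * x' * frameForm ε (oddVec n ε κ t) (oddVec n ε κ s) +
      x * y' * frameForm ε (oddVec n ε κ t) (evenVec n ε κ s) +
      y * x' * frameForm ε (evenVec n ε κ t) (oddVec n ε κ s) +
      y * y' * frameForm ε (evenVec n ε κ t) (evenVec n ε κ s) := by
    simp only [frameForm, Finset.mul_sum, ← Finset.sum_add_distrib]
    exact Finset.sum_congr rfl fun _ _ => by ring
  rw [this, h1, h2]
  ring

/-- The diagonal matrix with entries `ε 1, …, ε n`. -/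
def signMatrix (n : ℕ) (ε : ℕ → ℝ) : Matrix (Fin n) (Fin n) ℝ :=
  Matrix.diagonal fun p => ε (p + 1)

lemma transpose_mul_signMatrix_mul_apply {n : ℕ} (ε : ℕ → ℝ) (A B : Matrix (Fin n) (Fin n) ℝ)
    (i j : Fin n) :
    (A.transpose * signMatrix n ε * B) i j = frameForm ε (fun p => A p i) (fun p => B p j) := by
  rw [signMatrix, Matrix.mul_apply]
  simp only [Matrix.mul_diagonal, Matrix.transpose_apply, frameForm]
  exact Finset.sum_congr rfl fun _ _ => by ring

section

variable {k : ℕ} {ε κ lam w x y : ℕ → ℝ}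
  (hε : ∀ i ∈ Set.Icc 1 (2 * k + 1), ε i = 1 ∨ ε i = -1)
  (hκ : ∀ i ∈ Set.Icc 1 (2 * k), κ i ≠ 0)
  (hlam : ∀ l < k, lam (l + 1) ≠ 0)
  (hnode : ∀ l < k, IsNode k ε κ (node k lam (l + 1)))
  (hinj : ∀ l ≤ k, ∀ l' ≤ k, l ≠ l' → node k lam (l + 1) ≠ node k lam (l' + 1))

include hε hκ hlam hnode hinj

-- The index `l = k`, whose node is `0`, is included: there the factor `-t` vanishes, so `0` need
-- not satisfy `IsNode`.
omit hlam in
lemma frameForm_oddVec_of_ne {l l' : ℕ} (hl : l ≤ k) (hl' : l' < k) (h : l ≠ l') :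
    frameForm ε (oddVec (2 * k + 1) ε κ (node k lam (l + 1)))
      (oddVec (2 * k + 1) ε κ (node k lam (l' + 1))) = 0 := by
  rw [frameForm_oddVec hε hκ _ (hnode l' hl')]
  rcases hl.lt_or_eq with hlt | rfl
  · rw [frameForm_evenVec_eq_zero hε hκ (hnode l hlt) (hnode l' hl')
      (hinj l hl l' hl'.le h), mul_zero]
  · rw [node_last, neg_zero, zero_mul]

/-- Columns from different blocks are orthogonal because their nodes differ. Within a block, the
relation between odd and even squared lengths reduces the Gram entries to the squared length of the
block, and `hw` normalizes them. In the last column `y` vanishes, so its even vector never enters.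
-/
lemma blockFrame_gram (hk : 1 ≤ k) (hxy : IsBlockValue k lam w x y)
    (hw : ∀ l ≤ k, w (l + 1) * frameForm ε (oddVec (2 * k + 1) ε κ (node k lam (l + 1)))
      (oddVec (2 * k + 1) ε κ (node k lam (l + 1))) = 1) :
    (blockFrame k ε κ lam x y).transpose * signMatrix (2 * k + 1) ε * blockFrame k ε κ lam x y =
      metric (2 * k + 1) := by
  ext i j
  rw [transpose_mul_signMatrix_mul_apply, metric_apply]
  simp only [blockFrame, Matrix.of_apply]
  rw [frameForm_combination]
  -- As the even squared length is `-1/t` times the odd one `N`, the Gram entry is `(r r' - s s'/t)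
  -- N`, and `w N = 1`.
  have hdiag : ∀ l < k, ∀ r s r' s' g : ℝ,
      r * r' - s * s' / node k lam (l + 1) = g * w (l + 1) →
      r * r' * frameForm ε (oddVec (2 * k + 1) ε κ (node k lam (l + 1)))
        (oddVec (2 * k + 1) ε κ (node k lam (l + 1))) +
      s * s' * frameForm ε (evenVec (2 * k + 1) ε κ (node k lam (l + 1)))
        (evenVec (2 * k + 1) ε κ (node k lam (l + 1))) = g := by
    intro l hl r s r' s' g h
    have h1 := frameForm_oddVec hε hκ (node k lam (l + 1)) (hnode l hl)
    have h2 := hw l hl.le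
    have h3 : node k lam (l + 1) ≠ 0 := by
      rw [← node_last k lam]
      exact hinj l hl.le k le_rfl hl.ne
    rw [h1] at h2 ⊢
    have h4 : s * s' = s * s' / node k lam (l + 1) * node k lam (l + 1) := by field_simp
    rw [h4]
    linear_combination g * h2 - node k lam (l + 1) * frameForm ε
      (evenVec (2 * k + 1) ε κ (node k lam (l + 1)))
        (evenVec (2 * k + 1) ε κ (node k lam (l + 1))) * h
  have hblock : ∀ l < k, ∀ u v : ℝ, u * v / node k lam (l + 1) =
      -blockSign (l + 1) * (u / lam (l + 1)) * (v / lam (l + 1)) := by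
    intro l hl u v
    have h1 := blockSign_mul_self (l + 1)
    have h2 := hlam l hl
    have h3 : blockSign (l + 1) ≠ 0 := fun h => by rw [h] at h1; norm_num at h1
    rw [node_of_lt lam hl]
    field_simp
    linear_combination u * v * h1
  have hsgn : ∀ l, (if 2 * l = 0 then (-1 : ℝ) else 1) = blockSign (l + 1) := by
    intro l
    unfold blockSign
    congr 1
    simp
  have hi := i.2
  have hj := j.2
  by_cases hij : (i : ℕ) / 2 = j / 2
  · rw [← hij]
    rcases (show (i : ℕ) / 2 ≤ k by omega).lt_or_eq with hl | hl
    · have e1 := hxy.fst _ hl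
      have e2 := hxy.snd _ hl
      have e3 := hxy.norm _ hl
      have h2 := hlam _ hl
      have h1 := blockSign_mul_self ((i : ℕ) / 2 + 1)
      have q1 : y (2 * ((i : ℕ) / 2)) / lam ((i : ℕ) / 2 + 1) =
          -blockSign ((i : ℕ) / 2 + 1) * x (2 * ((i : ℕ) / 2) + 1) := by
        rw [e1]; field_simp
      have q2 : y (2 * ((i : ℕ) / 2) + 1) / lam ((i : ℕ) / 2 + 1) = x (2 * ((i : ℕ) / 2)) := by
        rw [e2]; field_simp
      apply hdiag _ hl
      rw [hblock _ hl]
      have h5 := hsgn ((i : ℕ) / 2)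
      set l := (i : ℕ) / 2
      rcases Nat.even_or_odd' (i : ℕ) with ⟨a, ha | ha⟩ <;>
        rcases Nat.even_or_odd' (j : ℕ) with ⟨b, hb | hb⟩
      · have i1 : (i : ℕ) = 2 * l := by omega
        have j1 : (j : ℕ) = 2 * l := by omega
        rw [if_pos (Fin.ext (by omega)), i1, j1, q1, h5]
        linear_combination blockSign (l + 1) * e3 - x (2 * l) ^ 2 * h1 +
          blockSign (l + 1) * x (2 * l + 1) ^ 2 * h1
      · have i1 : (i : ℕ) = 2 * l := by omega
        have j1 : (j : ℕ) = 2 * l + 1 := by omega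
        rw [if_neg (fun h => by rw [h] at i1; omega), i1, j1, q1, q2]
        linear_combination -x (2 * l) * x (2 * l + 1) * h1
      · have i1 : (i : ℕ) = 2 * l + 1 := by omega
        have j1 : (j : ℕ) = 2 * l := by omega
        rw [if_neg (fun h => by rw [h] at i1; omega), i1, j1, q1, q2]
        linear_combination -x (2 * l) * x (2 * l + 1) * h1
      · have i1 : (i : ℕ) = 2 * l + 1 := by omega
        have j1 : (j : ℕ) = 2 * l + 1 := by omega
        rw [if_pos (Fin.ext (by omega)), if_neg (by omega), i1, j1, q2]
        linear_combination e3
    · have i1 : (i : ℕ) = 2 * k := by omega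
      have j1 : (j : ℕ) = 2 * k := by omega
      have e := hw k le_rfl
      rw [if_pos (Fin.ext (by omega)), if_neg (by omega), hl, i1, j1, hxy.last, ← e,
        ← hxy.norm_last]
      ring
  · rw [if_neg (fun h => hij (by rw [h]))]
    have key : ∀ l ≤ k, ∀ l' < k, l ≠ l' → frameForm ε (oddVec (2 * k + 1) ε κ (node k lam (l + 1)))
        (oddVec (2 * k + 1) ε κ (node k lam (l' + 1))) = 0 := fun l hl l' hl' h =>
      frameForm_oddVec_of_ne hε hκ hnode hinj hl hl' h
    rcases (show (i : ℕ) / 2 ≤ k by omega).lt_or_eq with hl | hl <;>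
      rcases (show (j : ℕ) / 2 ≤ k by omega).lt_or_eq with hl' | hl'
    · rw [key _ hl.le _ hl' hij, frameForm_evenVec_eq_zero hε hκ (hnode _ hl) (hnode _ hl')
        (hinj _ hl.le _ hl'.le hij)]
      ring
    · have j1 : (j : ℕ) = 2 * k := by omega
      rw [frameForm_comm, key _ hl'.le _ hl (Ne.symm hij), j1, hxy.last]
      ring
    · have i1 : (i : ℕ) = 2 * k := by omega
      rw [key _ hl.le _ hl' hij, i1, hxy.last]
      ring
    · omega

-- On each column `M` replaces the pair `(x, y)` by `(y, t x)`, which is differentiation when `x' =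
-- y` and `y' = t x`.
omit hlam hinj in
lemma frameMatrix_mul_blockFrame (hlast : y (2 * k) = 0) :
    frameMatrix (2 * k + 1) ε κ * blockFrame k ε κ lam x y =
      blockFrame k ε κ lam y (fun j => node k lam (j / 2 + 1) * x j) := by
  ext p j
  have hj := j.2
  have hcol : (fun q => blockFrame k ε κ lam x y q j) =
      x j • oddVec (2 * k + 1) ε κ (node k lam (j / 2 + 1)) +
        y j • evenVec (2 * k + 1) ε κ (node k lam (j / 2 + 1)) := rfl
  have : (frameMatrix (2 * k + 1) ε κ * blockFrame k ε κ lam x y) p j =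
      (frameMatrix (2 * k + 1) ε κ).mulVec (fun q => blockFrame k ε κ lam x y q j) p := rfl
  rw [this, hcol, Matrix.mulVec_add, Matrix.mulVec_smul, Matrix.mulVec_smul,
    mulVec_oddVec hε hκ]
  simp only [blockFrame, Matrix.of_apply, Pi.add_apply, Pi.smul_apply, smul_eq_mul]
  rcases (show (j : ℕ) / 2 ≤ k by omega).lt_or_eq with hl | hl
  · rw [mulVec_evenVec hε hκ (hnode _ hl)]
    ring
  · have j1 : (j : ℕ) = 2 * k := by omega
    rw [hl, node_last, j1, hlast]
    ring

end

/-! ### Squared lengths of the rows -/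

lemma sum_range_blocks (k : ℕ) (g : ℕ → ℝ) :
    ∑ j ∈ Finset.range (2 * k + 1), g j =
      ∑ l ∈ Finset.range k, (g (2 * l) + g (2 * l + 1)) + g (2 * k) := by
  rw [Finset.sum_range_succ]
  congr 1
  induction k with
  | zero => simp
  | succ k ih =>
    rw [Finset.sum_range_succ _ k, ← ih, mul_add, mul_one, Finset.sum_range_succ,
      Finset.sum_range_succ]
    ring

/-- Differentiation multiplies the squared length of a block by `-t`, hence the factor in the second
sum, where the last coordinate drops out. -/
lemma lor_row {k : ℕ} (hk : 1 ≤ k) {lam w x y : ℕ → ℝ} (hxy : IsBlockValue k lam w x y) (q : ℝ → ℝ) :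
    lor (fun j : Fin (2 * k + 1) => x j * q (node k lam (j / 2 + 1)))
      (fun j => x j * q (node k lam (j / 2 + 1))) =
      ∑ l ∈ Finset.Icc 1 k, w l * q (sqEigenvalue lam l) ^ 2 + w (k + 1) * q 0 ^ 2 ∧
    lor (fun j : Fin (2 * k + 1) => y j * q (node k lam (j / 2 + 1)))
      (fun j => y j * q (node k lam (j / 2 + 1))) =
      ∑ l ∈ Finset.Icc 1 k, -(w l * sqEigenvalue lam l * q (sqEigenvalue lam l) ^ 2) := by
  have hI : ∀ g : ℕ → ℝ, ∑ l ∈ Finset.Icc 1 k, g l = ∑ l ∈ Finset.range k, g (l + 1) := by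
    intro g
    rw [Finset.range_eq_Ico, Finset.sum_Ico_add' g 0 k 1]
    rfl
  have hsum : ∀ z : ℕ → ℝ, lor (fun j : Fin (2 * k + 1) => z j * q (node k lam (j / 2 + 1)))
      (fun j => z j * q (node k lam (j / 2 + 1))) =
      ∑ l ∈ Finset.range k, (blockSign (l + 1) * z (2 * l) ^ 2 + z (2 * l + 1) ^ 2) *
        q (sqEigenvalue lam (l + 1)) ^ 2 +
        (if 2 * k = 0 then -1 else 1) * z (2 * k) ^ 2 * q 0 ^ 2 := by
    intro z
    rw [lor_eq_sum, Fin.sum_univ_eq_sum_range (fun j : ℕ => (if j = 0 then -1 else 1) *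
      (z j * q (node k lam (j / 2 + 1))) * (z j * q (node k lam (j / 2 + 1)))) (2 * k + 1),
      sum_range_blocks]
    congr 1
    · refine Finset.sum_congr rfl fun l hl => ?_
      rw [Finset.mem_range] at hl
      have e1 : 2 * l / 2 = l := by omega
      have e2 : (2 * l + 1) / 2 = l := by omega
      have e3 : node k lam (l + 1) = sqEigenvalue lam (l + 1) := if_neg (by omega)
      have e4 : (if 2 * l = 0 then (-1 : ℝ) else 1) = blockSign (l + 1) := by
        unfold blockSign
        congr 1
        simp
      rw [e1, e2, e3, e4, if_neg (by omega)]
      ring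
    · have e1 : 2 * k / 2 = k := by omega
      rw [e1, node_last]
      ring
  constructor
  · rw [hsum, hI, if_neg (by omega), one_mul, hxy.norm_last]
    congr 1
    refine Finset.sum_congr rfl fun l hl => ?_
    rw [hxy.norm l (Finset.mem_range.1 hl)]
  · rw [hsum, hI, hxy.last]
    simp only [ne_eq, OfNat.ofNat_ne_zero, not_false_eq_true, zero_pow, mul_zero, zero_mul,
      add_zero]
    refine Finset.sum_congr rfl fun l hl => ?_
    rw [hxy.fst l (Finset.mem_range.1 hl), hxy.snd l (Finset.mem_range.1 hl),
      ← hxy.norm l (Finset.mem_range.1 hl), sqEigenvalue_eq]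
    have h1 := blockSign_mul_self (l + 1)
    linear_combination (blockSign (l + 1) * lam (l + 1) ^ 2 * x (2 * l + 1) ^ 2 -
      x (2 * l) ^ 2 * lam (l + 1) ^ 2) *
      q (-blockSign (l + 1) * lam (l + 1) ^ 2) ^ 2 * h1


/-! ### Self-similar curves with the same curvatures are p-similar -/

section

variable {k : ℕ} {I : Set ℝ} {α : ℝ → Fin (2 * k + 1) → ℝ} {e : ℕ → ℝ → Fin (2 * k + 1) → ℝ}
  {ε κ : ℕ → ℝ}

lemma IsFrenetCurve.lnorm_pos {n : ℕ} {α : ℝ → Fin n → ℝ} {e : ℕ → ℝ → Fin n → ℝ}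
    (hα : IsFrenetCurve I α e ε) {σ : ℝ} (hσI : σ ∈ I) :
    0 < lnorm (deriv α σ) :=
  Real.sqrt_pos.2 (abs_pos.2 (hα.nonNull σ hσI))

lemma IsFrenetCurve.deriv_frame {n : ℕ} {α : ℝ → Fin n → ℝ} {e : ℕ → ℝ → Fin n → ℝ}
    (hα : IsFrenetCurve I α e ε) {σ : ℝ} (hσI : σ ∈ I) (i : ℕ) :
    deriv (e i) σ = lnorm (deriv α σ) • arcDeriv α (e i) σ := by
  rw [arcDeriv, smul_smul, mul_inv_cancel₀ (hα.lnorm_pos hσI).ne', one_smul]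

lemma lnorm_smul {n : ℕ} (r : ℝ) (x : Fin n → ℝ) : lnorm (r • x) = |r| * lnorm x := by
  have h : lor (r • x) (r • x) = r ^ 2 * lor x x := by
    simp only [lor_eq_sum, Finset.mul_sum, Pi.smul_apply, smul_eq_mul]
    exact Finset.sum_congr rfl fun _ _ => by ring
  rw [lnorm, h, abs_mul, abs_of_nonneg (sq_nonneg r), Real.sqrt_mul (sq_nonneg r),
    Real.sqrt_sq_eq_abs, lnorm]

/-- The spherical speed is the speed of `α` times `κ_1`, since `ε_2 e_2` is a unit vector. -/
lemma IsFrenetCurve.lnorm_mul_curvature (hk : 1 ≤ k) (hα : IsFrenetCurve I α e ε)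
    (hσ : IsSphericalArcLength I e) {σ : ℝ} (hσI : σ ∈ I) :
    lnorm (deriv α σ) * curvature α e 1 σ = 1 := by
  have h2 : (2 : ℕ) ∈ Set.Icc 1 (2 * k + 1) := ⟨by omega, by omega⟩
  have h := hσ σ hσI
  have habs : |ε 2| = 1 := by rcases hα.sign 2 h2 with h | h <;> rw [h] <;> simp
  have hn : lnorm (e 2 σ) = 1 := by rw [lnorm, hα.norm_self 2 h2 σ hσI, habs, Real.sqrt_one]
  rw [hα.deriv_frame hσI, hα.frenet_first σ hσI, lnorm_smul, lnorm_smul, hn, abs_mul, habs,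
    abs_of_pos (hα.lnorm_pos hσI), abs_of_pos (hα.curvature_pos 1 le_rfl (by omega) σ hσI)] at h
  linarith

lemma IsFrenetCurve.lnorm_mul_curvature_eq (hk : 1 ≤ k) (hα : IsFrenetCurve I α e ε)
    (hσ : IsSphericalArcLength I e) (hself : IsSelfSimilarWith I α e κ) {σ : ℝ} (hσI : σ ∈ I)
    {i : ℕ} (h1 : 1 ≤ i) (hi : i ≤ 2 * k) :
    lnorm (deriv α σ) * curvature α e i σ = shapeCoeff κ i := by
  have h := hα.lnorm_mul_curvature hk hσ hσI
  unfold shapeCoeff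
  split_ifs with hi1
  · rw [hi1, h]
  · have hs := hself i h1 (by omega) σ hσI
    rw [pShape, if_neg hi1] at hs
    have h0 := (hα.curvature_pos 1 le_rfl (by omega) σ hσI).ne'
    rw [← hs, eq_div_iff h0]
    linear_combination curvature α e i σ * h

/-- The matrix with rows `e 1, …, e n`. -/
def rowMatrix {n : ℕ} (e : ℕ → ℝ → Fin n → ℝ) (σ : ℝ) : Matrix (Fin n) (Fin n) ℝ :=
  Matrix.of fun p j => e (p + 1) σ j

lemma IsFrenetCurve.hasDerivAt_rowMatrix (hk : 1 ≤ k) (hα : IsFrenetCurve I α e ε)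
    (hσ : IsSphericalArcLength I e) (hself : IsSelfSimilarWith I α e κ) {σ : ℝ} (hσI : σ ∈ I)
    (p j : Fin (2 * k + 1)) :
    HasDerivAt (fun s => rowMatrix e s p j)
      ((frameMatrix (2 * k + 1) ε κ * rowMatrix e σ) p j) σ := by
  have hp := p.2
  have hd := (hasDerivAt_pi.1
    (hα.differentiable (p + 1) ⟨by omega, by omega⟩ σ hσI).hasDerivAt) j
  refine hd.congr_deriv (Eq.symm ?_)
  have hm := fun (i : ℕ) => hα.lnorm_mul_curvature_eq (i := i) hk hσ hself hσI
  let g : ℕ → ℝ := fun i => if 1 ≤ i ∧ i ≤ 2 * k + 1 then e i σ j else 0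
  have hg : (fun q => rowMatrix e σ q j) = fun q : Fin (2 * k + 1) => g (q + 1) := by
    ext q
    have hq := q.2
    simp only [g]
    rw [if_pos ⟨by omega, by omega⟩]
    rfl
  have hrow : (frameMatrix (2 * k + 1) ε κ * rowMatrix e σ) p j =
      (frameMatrix (2 * k + 1) ε κ).mulVec (fun q => rowMatrix e σ q j) p := rfl
  rw [hrow, hg, frameMatrix_mulVec ε κ g (by simp [g]) (by simp [g]), hα.deriv_frame hσI]
  rcases Nat.eq_zero_or_pos (p : ℕ) with h0 | h0
  · have h1 := hm 1 le_rfl (by omega)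
    have g2 : g 2 = e 2 σ j := if_pos ⟨by omega, by omega⟩
    have g0 : g 0 = 0 := if_neg (by omega)
    rw [h0, zero_add, zero_add, hα.frenet_first σ hσI, g0, g2]
    simp only [Pi.smul_apply, smul_eq_mul]
    linear_combination -(ε 2 * e 2 σ j) * h1
  · have gp : g p = e p σ j := if_pos ⟨by omega, by omega⟩
    have m1 := hm p (by omega) (by omega)
    rcases (show (p : ℕ) ≤ 2 * k by omega).lt_or_eq with hl | hl
    · have m2 := hm (p + 1) (by omega) (by omega)
      have g2 : g (p + 2) = e (p + 2) σ j := if_pos ⟨by omega, by omega⟩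
      rw [hα.frenet_mid (p + 1) (by omega) (by omega) σ hσI, gp, g2, Nat.add_sub_cancel]
      simp only [Pi.smul_apply, Pi.add_apply, smul_eq_mul]
      linear_combination ε p * e p σ j * m1 - ε (p + 2) * e (p + 2) σ j * m2
    · have g2 : g (p + 2) = 0 := if_neg (by omega)
      have := hα.frenet_last σ hσI
      rw [Nat.add_sub_cancel] at this
      rw [g2, gp, hl, this]
      rw [hl] at m1
      simp only [Pi.smul_apply, smul_eq_mul]
      linear_combination ε (2 * k) * e (2 * k) σ j * m1

lemma IsFrenetCurve.rowMatrix_gram {n : ℕ} {α : ℝ → Fin n → ℝ} {e : ℕ → ℝ → Fin n → ℝ}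
    (hα : IsFrenetCurve I α e ε) {σ : ℝ} (hσI : σ ∈ I) :
    rowMatrix e σ * metric n * (rowMatrix e σ).transpose = signMatrix n ε := by
  ext p q
  have hp := p.2
  have hq := q.2
  have : (rowMatrix e σ * metric n * (rowMatrix e σ).transpose) p q =
      lor (e (p + 1) σ) (e (q + 1) σ) := by
    rw [lor_eq_sum, metric, Matrix.mul_apply]
    simp only [Matrix.mul_diagonal, Matrix.transpose_apply, rowMatrix, Matrix.of_apply]
    exact Finset.sum_congr rfl fun _ _ => by ring
  rw [this, signMatrix, Matrix.diagonal_apply]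
  split_ifs with h
  · rw [← h]
    exact hα.norm_self _ ⟨by omega, by omega⟩ σ hσI
  · exact hα.orthogonal _ ⟨by omega, by omega⟩ _ ⟨by omega, by omega⟩
      (fun h' => h (Fin.ext (by omega))) σ hσI

lemma eqOn_of_hasDerivAt_zero (hI : IsOpen I) (hIc : I.OrdConnected) {f : ℝ → ℝ}
    (hf : ∀ σ ∈ I, HasDerivAt f 0 σ) {s t : ℝ} (hs : s ∈ I) (ht : t ∈ I) : f s = f t :=
  hI.is_const_of_deriv_eq_zero hIc.isPreconnected
    (fun σ h => (hf σ h).differentiableAt.differentiableWithinAt) (fun σ h => (hf σ h).deriv) hs ht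

lemma curvature_eq_exp (hk : 1 ≤ k) (hI : IsOpen I) (hIc : I.OrdConnected)
    (hα : IsFrenetCurve I α e ε) (hκ : κ 1 ≠ 0) (hself : IsSelfSimilarWith I α e κ)
    {s t : ℝ} (hs : s ∈ I) (ht : t ∈ I) :
    curvature α e 1 s * Real.exp (κ 1 * s) = curvature α e 1 t * Real.exp (κ 1 * t) := by
  refine eqOn_of_hasDerivAt_zero (f := fun r => curvature α e 1 r * Real.exp (κ 1 * r)) hI hIc
    (fun σ hσI => ?_) hs ht
  have h0 := (hα.curvature_pos 1 le_rfl (by omega) σ hσI).ne'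
  have h := hself 1 le_rfl (by omega) σ hσI
  rw [pShape, if_pos rfl] at h
  -- A non-differentiable `κ_1` would have `deriv` equal to `0`, hence `κ̃_1 = 0`, which is
  -- excluded.
  have hd : DifferentiableAt ℝ (curvature α e 1) σ := by
    by_contra hnd
    rw [deriv_zero_of_not_differentiableAt hnd, mul_zero] at h
    exact hκ h.symm
  have he : deriv (curvature α e 1) σ = -κ 1 * curvature α e 1 σ := by
    rw [← h]
    field_simp
  have h1 := hd.hasDerivAt.mul ((hasDerivAt_id σ).const_mul (κ 1)).exp
  refine h1.congr_deriv ?_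
  rw [he]
  simp only [id]
  ring

lemma metric_mul_metric (n : ℕ) : metric n * metric n = 1 := by
  rw [metric, Matrix.diagonal_mul_diagonal, ← Matrix.diagonal_one]
  congr 1
  ext i
  split_ifs <;> norm_num

lemma isSymm_metric (n : ℕ) : (metric n).transpose = metric n := Matrix.diagonal_transpose _

lemma signMatrix_mul_signMatrix {n : ℕ} (hε : ∀ i ∈ Set.Icc 1 n, ε i = 1 ∨ ε i = -1) :
    signMatrix n ε * signMatrix n ε = 1 := by
  rw [signMatrix, Matrix.diagonal_mul_diagonal, ← Matrix.diagonal_one]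
  congr 1
  ext i
  have hi := i.2
  rcases hε (i + 1) ⟨by omega, by omega⟩ with h | h <;> rw [h] <;> norm_num

lemma isSymm_signMatrix (n : ℕ) (ε : ℕ → ℝ) : (signMatrix n ε).transpose = signMatrix n ε :=
  Matrix.diagonal_transpose _

lemma signMatrix_mul_frameMatrix {n : ℕ} (hε : ∀ i ∈ Set.Icc 1 n, ε i = 1 ∨ ε i = -1) :
    (frameMatrix n ε κ).transpose * signMatrix n ε = -(signMatrix n ε * frameMatrix n ε κ) := by
  ext p q
  simp only [signMatrix, Matrix.mul_diagonal, Matrix.diagonal_mul, Matrix.transpose_apply,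
    Matrix.neg_apply]
  rw [← sign_mul_frameMatrix hε, mul_comm]

/-- If `Fᵀ D F = G` with square roots of unity `D`, `G`, then `F G Fᵀ = D`. -/
lemma gram_transpose {n : ℕ} {D G F : Matrix (Fin n) (Fin n) ℝ} (hD : D * D = 1) (hG : G * G = 1)
    (h : F.transpose * D * F = G) : F * G * F.transpose = D := by
  have h1 : G * F.transpose * D * F = 1 := by
    rw [← hG, ← h]
    simp only [Matrix.mul_assoc]
  have h2 := mul_eq_one_comm.1 h1
  calc F * G * F.transpose = F * (G * F.transpose * D) * D := by
        simp only [Matrix.mul_assoc, hD, Matrix.mul_one]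
    _ = D := by rw [h2, Matrix.one_mul]

/-- Write `E` for `rowMatrix e`. The matrix `A = Fᵀ D E G` is constant and pseudo-orthogonal and
sends each `e i` to the corresponding row of `F`. With `C = κ_1 e^{κ̃_1 σ}`, also constant, `C A α`
has the same derivative as `β`. -/
theorem exists_isPSimilarity (hk : 1 ≤ k) (hI : IsOpen I) (hIc : I.OrdConnected)
    (hne : I.Nonempty) (hα : IsFrenetCurve I α e ε) (hσ : IsSphericalArcLength I e)
    (hκ : κ 1 ≠ 0) (hself : IsSelfSimilarWith I α e κ)
    {F : ℝ → Matrix (Fin (2 * k + 1)) (Fin (2 * k + 1)) ℝ}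
    (hF : ∀ σ p j, HasDerivAt (fun s => F s p j) ((frameMatrix (2 * k + 1) ε κ * F σ) p j) σ)
    (hgram : ∀ σ, (F σ).transpose * signMatrix (2 * k + 1) ε * F σ = metric (2 * k + 1))
    {β : ℝ → Fin (2 * k + 1) → ℝ}
    (hβ : ∀ σ j, HasDerivAt (fun s => β s j) (Real.exp (κ 1 * σ) * F σ 0 j) σ) :
    ∃ f, IsPSimilarity f ∧ ∀ σ ∈ I, f (α σ) = β σ := by
  obtain ⟨σ₀, hσ₀⟩ := hne
  have hε := hα.sign
  set D := signMatrix (2 * k + 1) ε with hDdef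
  set G := metric (2 * k + 1) with hGdef
  have hD : D * D = 1 := signMatrix_mul_signMatrix hε
  have hG : G * G = 1 := metric_mul_metric _
  have hDt : D.transpose = D := isSymm_signMatrix _ _
  have hGt : G.transpose = G := isSymm_metric _
  set M := frameMatrix (2 * k + 1) ε κ with hM
  have hMD : M.transpose * D = -(D * M) := signMatrix_mul_frameMatrix hε
  have hconst : ∀ σ ∈ I, (F σ).transpose * D * rowMatrix e σ =
      (F σ₀).transpose * D * rowMatrix e σ₀ := by
    intro σ hσI
    ext i j
    refine eqOn_of_hasDerivAt_zero (f := fun s => ((F s).transpose * D * rowMatrix e s) i j)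
      hI hIc (fun τ hτ => ?_) hσI hσ₀
    -- The product rule gives `Fᵀ (Mᵀ D + D M) E`, which is zero by skewness.
    have hzero : (M * F τ).transpose * D * rowMatrix e τ +
        (F τ).transpose * D * (M * rowMatrix e τ) = 0 := by
      rw [Matrix.transpose_mul, Matrix.mul_assoc _ _ D, hMD]
      simp only [Matrix.mul_neg, Matrix.neg_mul, Matrix.mul_assoc, neg_add_cancel]
    have hz := congrFun (congrFun hzero i) j
    rw [Matrix.add_apply, hDdef, transpose_mul_signMatrix_mul_apply,
      transpose_mul_signMatrix_mul_apply] at hz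
    simp only [hDdef, transpose_mul_signMatrix_mul_apply, frameForm] at hz ⊢
    rw [← Finset.sum_add_distrib] at hz
    have hs : HasDerivAt (fun s => ∑ p : Fin (2 * k + 1), ε (p + 1) * F s p i * rowMatrix e s p j)
        (∑ p : Fin (2 * k + 1), (ε (p + 1) * (M * F τ) p i * rowMatrix e τ p j +
          ε (p + 1) * F τ p i * (M * rowMatrix e τ) p j)) τ :=
      HasDerivAt.fun_sum fun p _ => ((hF τ p i).const_mul (ε (p + 1))).mul
        (hα.hasDerivAt_rowMatrix hk hσ hself hτ p j)
    rw [hz] at hs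
    exact hs
  set A := (F σ₀).transpose * D * rowMatrix e σ₀ * G with hA
  have hE : ∀ σ ∈ I, rowMatrix e σ * G * (rowMatrix e σ).transpose = D := fun σ h =>
    hα.rowMatrix_gram h
  have hAorth : A.transpose * G * A = G := by
    have h1 := gram_transpose hD hG (hgram σ₀)
    have h2 := gram_transpose (F := (rowMatrix e σ₀).transpose) hG hD
      (by rw [Matrix.transpose_transpose]; exact hE σ₀ hσ₀)
    rw [Matrix.transpose_transpose] at h2
    calc A.transpose * G * A = G * (rowMatrix e σ₀).transpose * D *
          (F σ₀ * G * (F σ₀).transpose) * D * rowMatrix e σ₀ * G := by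
          rw [hA]
          simp only [Matrix.transpose_mul, Matrix.transpose_transpose, hGt, hDt, Matrix.mul_assoc]
      _ = G * ((rowMatrix e σ₀).transpose * (D * D) * D * rowMatrix e σ₀) * G := by
          rw [h1]
          simp only [Matrix.mul_assoc]
      _ = G := by rw [hD, Matrix.mul_one, h2, hG, Matrix.one_mul]
  have hAe : ∀ σ ∈ I, A.mulVec (e 1 σ) = fun j => F σ 0 j := by
    intro σ hσI
    have h1 : A * (rowMatrix e σ).transpose = (F σ).transpose := by
      rw [hA, ← hconst σ hσI]
      calc (F σ).transpose * D * rowMatrix e σ * G * (rowMatrix e σ).transpose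
          = (F σ).transpose * D * (rowMatrix e σ * G * (rowMatrix e σ).transpose) := by
            simp only [Matrix.mul_assoc]
        _ = (F σ).transpose := by rw [hE σ hσI, Matrix.mul_assoc, hD, Matrix.mul_one]
    ext j
    exact congrFun (congrFun h1 j) 0
  have hdet : A.det = 1 ∨ A.det = -1 := by
    have h := congrArg Matrix.det hAorth
    rw [Matrix.det_mul, Matrix.det_mul, Matrix.det_transpose] at h
    have hGd : G.det ≠ 0 := by
      have := congrArg Matrix.det hG
      rw [Matrix.det_mul, Matrix.det_one] at this
      intro h0
      rw [h0] at this
      norm_num at this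
    have : A.det * A.det = 1 := by
      apply mul_right_cancel₀ hGd
      linear_combination h
    exact mul_self_eq_one_iff.1 this
  set C := curvature α e 1 σ₀ * Real.exp (κ 1 * σ₀) with hC
  have hC0 : C ≠ 0 :=
    mul_ne_zero (hα.curvature_pos 1 le_rfl (by omega) σ₀ hσ₀).ne' (Real.exp_ne_zero _)
  have hderiv : ∀ σ ∈ I, HasDerivAt (fun s => C • A.mulVec (α s)) (deriv β σ) σ := by
    intro σ hσI
    -- Otherwise `deriv α σ` would be `0`, which is null.
    have hd : DifferentiableAt ℝ α σ := by
      by_contra hnd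
      apply hα.nonNull σ hσI
      rw [deriv_zero_of_not_differentiableAt hnd]
      simp [lor]
    have hCσ : C * lnorm (deriv α σ) = Real.exp (κ 1 * σ) := by
      rw [hC, ← curvature_eq_exp hk hI hIc hα hκ hself hσI hσ₀]
      linear_combination Real.exp (κ 1 * σ) * hα.lnorm_mul_curvature hk hσ hσI
    have h1 : HasDerivAt (fun s => C • A.mulVec (α s)) (C • A.mulVec (deriv α σ)) σ := by
      refine HasDerivAt.const_smul C ?_
      rw [hasDerivAt_pi]
      intro i
      exact HasDerivAt.fun_sum (u := Finset.univ) fun j _ =>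
        ((hasDerivAt_pi.1 hd.hasDerivAt) j).const_mul (A i j)
    refine h1.congr_deriv ?_
    rw [hα.tangent σ hσI, Matrix.mulVec_smul, hAe σ hσI, smul_smul, hCσ]
    exact (hasDerivAt_pi.2 (hβ σ)).deriv.symm
  have hβd : ∀ σ, HasDerivAt β (deriv β σ) σ := fun σ =>
    (hasDerivAt_pi.2 (hβ σ)).differentiableAt.hasDerivAt
  set b := β σ₀ - C • A.mulVec (α σ₀) with hb
  have hmain : ∀ σ ∈ I, C • A.mulVec (α σ) + b = β σ := by
    intro σ hσI
    ext j
    have := eqOn_of_hasDerivAt_zero (f := fun s => (β s - C • A.mulVec (α s)) j) hI hIc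
      (fun τ hτ => by
        have h := (hasDerivAt_pi.1 ((hβd τ).sub (hderiv τ hτ))) j
        simpa using h) hσI hσ₀
    simp only [hb, Pi.sub_apply, Pi.add_apply] at this ⊢
    linarith
  rcases hdet with h | h
  · exact ⟨fun x => C • A.mulVec x + b, ⟨C, A, b, hC0, hAorth, h, fun _ => rfl⟩, hmain⟩
  -- In odd dimension `-A` has determinant `1`, and the sign is absorbed in the scale factor.
  · refine ⟨fun x => C • A.mulVec x + b, ⟨-C, -A, b, neg_ne_zero.2 hC0, ?_, ?_, fun x => ?_⟩, hmain⟩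
    · rw [Matrix.transpose_neg, Matrix.neg_mul, Matrix.neg_mul, Matrix.mul_neg, neg_neg, hAorth]
    · rw [Matrix.det_neg, h, Fintype.card_fin, Odd.neg_one_pow ⟨k, rfl⟩]
      norm_num
    · rw [Matrix.neg_mulVec, smul_neg, neg_smul, neg_neg]

end


/-! ### The coefficients -/

/-- The squared lengths of the blocks of `e 1`, where `s` is the sign of `e 1`. -/
def blockWeight (k : ℕ) (c s : ℝ) (a : ℕ → ℝ) (l : ℕ) : ℝ :=
  if l = 1 then s * a 1 ^ 2 else if l = k + 1 then c ^ 2 * a (k + 1) ^ 2 else a l ^ 2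

lemma exists_coefficients {k : ℕ} (hk : 1 ≤ k) {c s : ℝ} (hc : c ≠ 0) (hs : s = 1 ∨ s = -1)
    {N : ℕ → ℝ} (h1 : 0 < s * N 1) (hN : ∀ l, 1 ≤ l → l ≤ k → 0 < N (l + 1)) :
    ∃ a : ℕ → ℝ, (∀ i ∈ Set.Icc 1 (k + 1), a i ≠ 0) ∧
      ∀ l ≤ k, blockWeight k c s a (l + 1) * N (l + 1) = 1 := by
  -- Each `a i` solves weight times `N i` equal to `1`; the extra `c` appears because the last
  -- coordinate of `e 1` is `c a_{k+1}`.
  refine ⟨fun i => if i = 1 then (Real.sqrt (s * N 1))⁻¹ else if i = k + 1 then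
    (c * Real.sqrt (N (k + 1)))⁻¹ else (Real.sqrt (N i))⁻¹, ?_, ?_⟩
  · intro i hi
    have hi1 := hi.1
    have hi2 := hi.2
    by_cases h : i = 1
    · simp only [h, if_true]
      exact inv_ne_zero (Real.sqrt_pos.2 h1).ne'
    · obtain ⟨l, rfl⟩ : ∃ l, i = l + 1 := ⟨i - 1, by omega⟩
      have hl := hN l (by omega) (by omega)
      simp only [h, if_false]
      split_ifs with h'
      · rw [← h']
        exact inv_ne_zero (mul_ne_zero hc (Real.sqrt_pos.2 hl).ne')
      · exact inv_ne_zero (Real.sqrt_pos.2 hl).ne'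
  · intro l hl
    by_cases h : l = 0
    · have hs2 : s * s = 1 := by rcases hs with h | h <;> rw [h] <;> norm_num
      have h3 : s ≠ 0 := by rcases hs with h | h <;> rw [h] <;> norm_num
      have h4 : N 1 ≠ 0 := fun h => by rw [h, mul_zero] at h1; exact lt_irrefl _ h1
      simp only [blockWeight, h, zero_add, if_true]
      rw [inv_pow, Real.sq_sqrt h1.le]
      field_simp
    · have hp := hN l (by omega) hl
      have h2 : l + 1 ≠ 1 := by omega
      have h3 : k + 1 ≠ 1 := by omega
      simp only [blockWeight, h2, h3, if_false, if_true]
      split_ifs with h'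
      · rw [h'] at hp ⊢
        rw [inv_pow, mul_pow, Real.sq_sqrt hp.le]
        field_simp
      · rw [inv_pow, Real.sq_sqrt hp.le]
        field_simp

/-! ### The derivatives of the models -/

/-- The functions `x j = e^{-cσ} β_j'` for a model `β`, where `P` and `Q` are those of the first
block. -/
noncomputable def tangentCoord (k : ℕ) (c : ℝ) (lam a : ℕ → ℝ) (P Q : ℝ → ℝ) (σ : ℝ) (j : ℕ) : ℝ :=
  let i : ℕ := j / 2 + 1
  let r : ℝ := a i / bCoeff c lam i
  let θ : ℝ := phase c lam i σ
  if j = 2 * k then c * a (k + 1)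
  else if j = 0 then P σ
  else if j = 1 then Q σ
  else if Even j then r * (c * Real.sin θ + lam i * Real.cos θ)
  else r * (lam i * Real.sin θ - c * Real.cos θ)

/-- The derivatives of the functions `tangentCoord`. -/
noncomputable def normalCoord (k : ℕ) (c : ℝ) (lam a : ℕ → ℝ) (P Q : ℝ → ℝ) (σ : ℝ) (j : ℕ) : ℝ :=
  let i : ℕ := j / 2 + 1
  let x := tangentCoord k c lam a P Q σ
  if j = 2 * k then 0
  else if Even j then -blockSign i * lam i * x (j + 1)
  else lam i * x (j - 1)

/-- The additive constants in the phases play no further role: the argument uses only this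
derivative and the identities for `cosh² - sinh²` and `sin² + cos²`. -/
lemma hasDerivAt_phase (c : ℝ) (lam : ℕ → ℝ) (i : ℕ) (σ : ℝ) :
    HasDerivAt (phase c lam i) (lam i) σ := by
  unfold phase
  by_cases h : i = 1
  · simp only [h, if_true]
    simpa using ((hasDerivAt_id σ).const_mul (lam 1)).sub_const
      (Real.arcosh (lam 1 / bCoeff c lam 1))
  · simp only [h, if_false]
    simpa using ((hasDerivAt_id σ).const_mul (lam i)).add_const
      (Real.arccos (lam i / bCoeff c lam i))

lemma bCoeff_sq {c : ℝ} {lam : ℕ → ℝ} {i : ℕ} (hi : i ≠ 1) :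
    bCoeff c lam i ^ 2 = lam i ^ 2 + c ^ 2 := by
  rw [bCoeff, if_neg hi, Real.sq_sqrt (by positivity)]

lemma bCoeff_one_sq {c : ℝ} {lam : ℕ → ℝ} (hb : c ^ 2 < lam 1 ^ 2) :
    bCoeff c lam 1 ^ 2 = lam 1 ^ 2 - c ^ 2 := by
  rw [bCoeff, if_pos rfl, Real.sq_sqrt (by linarith)]

section

variable {k : ℕ} {c s : ℝ} {lam a : ℕ → ℝ} {P Q : ℝ → ℝ}

lemma isBlockValue_tangentCoord (hk : 1 ≤ k) (hlam : ∀ l < k, lam (l + 1) ≠ 0)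
    (hPQ : ∀ σ, -P σ ^ 2 + Q σ ^ 2 = s * a 1 ^ 2) (σ : ℝ) :
    IsBlockValue k lam (blockWeight k c s a) (tangentCoord k c lam a P Q σ)
      (normalCoord k c lam a P Q σ) where
  fst l hl := by
    have e1 : 2 * l / 2 = l := by omega
    simp only [normalCoord]
    rw [if_neg (by omega), if_pos (even_two_mul l), e1]
  snd l hl := by
    have e1 : (2 * l + 1) / 2 = l := by omega
    simp only [normalCoord]
    rw [if_neg (by omega), if_neg (by grind), e1, Nat.add_sub_cancel]
  last := by simp [normalCoord]
  norm l hl := by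
    rcases Nat.eq_zero_or_pos l with rfl | h0
    · have h : (0 : ℕ) ≠ 2 * k := by omega
      have h' : (1 : ℕ) ≠ 2 * k := by omega
      simp [tangentCoord, blockSign, blockWeight, h, h', hPQ]
    · have e1 : (2 * l + 1) / 2 = l := by omega
      have e2 : 2 * l / 2 = l := by omega
      have hb := bCoeff_sq (c := c) (lam := lam) (i := l + 1) (by omega)
      have hb0 : bCoeff c lam (l + 1) ≠ 0 := by
        intro h
        rw [h] at hb
        have := hlam l hl
        have : 0 < lam (l + 1) ^ 2 + c ^ 2 := by positivity
        rw [← hb] at this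
        norm_num at this
      simp only [tangentCoord, blockSign, blockWeight, e1, e2]
      rw [if_neg (by omega), if_neg (by omega), if_neg (by omega), if_neg (by omega),
        if_pos (even_two_mul l), if_neg (by omega), if_neg (by omega), if_neg (by omega),
        if_neg (by grind), if_neg (by omega), if_neg (by omega)]
      have hsc := Real.sin_sq_add_cos_sq (phase c lam (l + 1) σ)
      generalize Real.sin (phase c lam (l + 1) σ) = S at *
      generalize Real.cos (phase c lam (l + 1) σ) = T at *
      field_simp
      rw [hb]
      linear_combination a (l + 1) ^ 2 * (lam (l + 1) ^ 2 + c ^ 2) * hsc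
  norm_last := by
    have h : k + 1 ≠ 1 := by omega
    simp only [tangentCoord, blockWeight, if_true, h, if_false]
    ring

lemma hasDerivAt_tangentCoord (hP : ∀ σ, HasDerivAt P (lam 1 * Q σ) σ)
    (hQ : ∀ σ, HasDerivAt Q (lam 1 * P σ) σ) (σ : ℝ) {j : ℕ} (hj : j < 2 * k + 1) :
    HasDerivAt (fun σ => tangentCoord k c lam a P Q σ j) (normalCoord k c lam a P Q σ j) σ := by
  have hθ := hasDerivAt_phase c lam (j / 2 + 1) σ
  by_cases h1 : j = 2 * k
  · simp only [tangentCoord, normalCoord, h1, if_true]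
    exact hasDerivAt_const _ _
  have h2k : ∀ l, 2 * l + 1 ≠ 2 * k := by omega
  rcases Nat.even_or_odd' j with ⟨l, rfl | rfl⟩
  · have e1 : 2 * l / 2 = l := by omega
    have e2 : (2 * l + 1) / 2 = l := by omega
    have e3 : ¬ Even (2 * l + 1) := by grind
    simp only [normalCoord]
    rw [if_neg h1, if_pos (even_two_mul l)]
    by_cases h0 : l = 0
    · subst h0
      have h1' : (0 : ℕ) ≠ 2 * k := h1
      simp only [tangentCoord]
      refine (hP σ).congr_deriv ?_ |>.congr_of_eventuallyEq ?_
      · simp [blockSign, h2k 0]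
      · simp [h1']
    · have h00 : 2 * l ≠ 0 := by omega
      have h01 : 2 * l ≠ 1 := by omega
      have h02 : 2 * l + 1 ≠ 0 := by omega
      have h03 : 2 * l + 1 ≠ 1 := by omega
      have h04 : l + 1 ≠ 1 := by omega
      rw [e1] at hθ
      simp only [tangentCoord, h1, h2k, h00, h01, h02, h03, h04, e1, e2, e3, even_two_mul,
        if_true, if_false, blockSign]
      refine (((hθ.sin.const_mul c).add (hθ.cos.const_mul (lam (l + 1)))).const_mul
        _).congr_deriv ?_
      ring
  · have e1 : 2 * l / 2 = l := by omega
    have e2 : (2 * l + 1) / 2 = l := by omega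
    have e3 : ¬ Even (2 * l + 1) := by grind
    have h2 : 2 * l ≠ 2 * k := by omega
    simp only [normalCoord]
    rw [if_neg h1, if_neg e3, Nat.add_sub_cancel]
    by_cases h0 : l = 0
    · subst h0
      have h1' : (0 : ℕ) ≠ 2 * k := h2
      simp only [tangentCoord]
      refine (hQ σ).congr_deriv ?_ |>.congr_of_eventuallyEq ?_
      · simp [h1']
      · simp [h2k 0]
    · have h00 : 2 * l ≠ 0 := by omega
      have h01 : 2 * l ≠ 1 := by omega
      have h02 : 2 * l + 1 ≠ 0 := by omega
      have h03 : 2 * l + 1 ≠ 1 := by omega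
      rw [e2] at hθ
      simp only [tangentCoord, h2, h2k, h00, h01, h02, h03, e1, e2, e3, even_two_mul,
        if_true, if_false]
      refine (((hθ.sin.const_mul (lam (l + 1))).sub (hθ.cos.const_mul c)).const_mul
        _).congr_deriv ?_
      ring

lemma hasDerivAt_normalCoord (hP : ∀ σ, HasDerivAt P (lam 1 * Q σ) σ)
    (hQ : ∀ σ, HasDerivAt Q (lam 1 * P σ) σ) (σ : ℝ) {j : ℕ} (hj : j < 2 * k + 1) :
    HasDerivAt (fun σ => normalCoord k c lam a P Q σ j)
      (node k lam (j / 2 + 1) * tangentCoord k c lam a P Q σ j) σ := by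
  by_cases h1 : j = 2 * k
  · have e1 : 2 * k / 2 = k := by omega
    simp only [h1, e1, node_last, zero_mul]
    simp only [normalCoord, if_true]
    exact hasDerivAt_const _ _
  rw [node_of_lt lam (by omega)]
  rcases Nat.even_or_odd' j with ⟨l, rfl | rfl⟩
  · have e2 : (2 * l + 1) / 2 = l := by omega
    have e1 : 2 * l / 2 = l := by omega
    have h := hasDerivAt_tangentCoord (c := c) (a := a) hP hQ σ (j := 2 * l + 1) (k := k) (by omega)
    have hn : normalCoord k c lam a P Q σ (2 * l + 1) =
        lam (l + 1) * tangentCoord k c lam a P Q σ (2 * l) := by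
      simp only [normalCoord]
      rw [if_neg (by omega), if_neg (by grind), e2, Nat.add_sub_cancel]
    rw [hn] at h
    simp only [normalCoord, h1, even_two_mul, if_true, if_false, e1]
    refine (h.const_mul _).congr_deriv ?_
    ring
  · have e2 : (2 * l + 1) / 2 = l := by omega
    have e1 : 2 * l / 2 = l := by omega
    have e3 : ¬ Even (2 * l + 1) := by grind
    have h := hasDerivAt_tangentCoord (c := c) (a := a) hP hQ σ (j := 2 * l) (k := k) (by omega)
    have hn : normalCoord k c lam a P Q σ (2 * l) =
        -blockSign (l + 1) * lam (l + 1) * tangentCoord k c lam a P Q σ (2 * l + 1) := by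
      simp only [normalCoord]
      rw [if_neg (by omega), if_pos (even_two_mul l), e1]
    rw [hn] at h
    simp only [normalCoord, h1, e3, if_false, e2, Nat.add_sub_cancel]
    refine (h.const_mul _).congr_deriv ?_
    ring

end

/-! ### The frames of the models -/

lemma hasDerivAt_blockFrame {k : ℕ} {ε κ lam : ℕ → ℝ} {x y : ℝ → ℕ → ℝ}
    (hε : ∀ i ∈ Set.Icc 1 (2 * k + 1), ε i = 1 ∨ ε i = -1) (hκ : ∀ i ∈ Set.Icc 1 (2 * k), κ i ≠ 0)
    (hnode : ∀ l < k, IsNode k ε κ (node k lam (l + 1)))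
    (hx : ∀ σ, ∀ j < 2 * k + 1, HasDerivAt (fun s => x s j) (y σ j) σ)
    (hy : ∀ σ, ∀ j < 2 * k + 1,
      HasDerivAt (fun s => y s j) (node k lam (j / 2 + 1) * x σ j) σ)
    (hlast : ∀ σ, y σ (2 * k) = 0) (σ : ℝ) (p j : Fin (2 * k + 1)) :
    HasDerivAt (fun s => blockFrame k ε κ lam (x s) (y s) p j)
      ((frameMatrix (2 * k + 1) ε κ * blockFrame k ε κ lam (x σ) (y σ)) p j) σ := by
  rw [frameMatrix_mul_blockFrame hε hκ hnode (hlast σ)]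
  exact ((hx σ j j.2).mul_const _).add ((hy σ j j.2).mul_const _)

/-- Each step of the frame recursion differentiates a coordinate, exchanging `x` and `y` up to the
factor `t`; the remaining scalars obey the recursion of `framePoly`. -/
lemma frame_eq {k : ℕ} {ε κ lam : ℕ → ℝ} {x y : ℝ → ℕ → ℝ}
    {Φ : ℕ → ℝ → Fin (2 * k + 1) → ℝ} (h0 : Φ 0 = 0) (h1 : ∀ σ, Φ 1 σ = fun j : Fin (2 * k + 1) => x σ j)
    (hΦ : ∀ i, i + 2 ≤ 2 * k + 1 → ∀ σ, Φ (i + 2) σ = (ε (i + 2) / shapeCoeff κ (i + 1)) •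
      (deriv (Φ (i + 1)) σ + (ε i * shapeCoeff κ i) • Φ i σ))
    (hx : ∀ σ, ∀ j < 2 * k + 1, HasDerivAt (fun s => x s j) (y σ j) σ)
    (hy : ∀ σ, ∀ j < 2 * k + 1,
      HasDerivAt (fun s => y s j) (node k lam (j / 2 + 1) * x σ j) σ) (i : ℕ) :
    i ≤ 2 * k + 1 → ∀ σ, Φ i σ = fun j : Fin (2 * k + 1) => (if Even i then y σ j else x σ j) *
      framePoly ε (shapeCoeff κ) (node k lam (j / 2 + 1)) i := by
  induction i using Nat.twoStepInduction with
  | zero => intro _ σ; ext j; simp [h0, framePoly]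
  | one => intro _ σ; ext j; simp [h1, framePoly]
  | more i ih1 ih2 =>
    intro hi σ
    have ih1 := ih1 (by omega) σ
    have ih2 := ih2 (by omega)
    have hd : HasDerivAt (Φ (i + 1)) (fun j : Fin (2 * k + 1) =>
        (if Even (i + 1) then node k lam (j / 2 + 1) * x σ j else y σ j) *
        framePoly ε (shapeCoeff κ) (node k lam (j / 2 + 1)) (i + 1)) σ := by
      rw [hasDerivAt_pi]
      intro j
      have : (fun s => Φ (i + 1) s j) = fun s => (if Even (i + 1) then y s j else x s j) *
          framePoly ε (shapeCoeff κ) (node k lam (j / 2 + 1)) (i + 1) := by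
        ext s
        rw [ih2 s]
      rw [this]
      by_cases he : Even (i + 1)
      · simp only [he, if_true]
        exact (hy σ j j.2).mul_const _
      · simp only [he, if_false]
        exact (hx σ j j.2).mul_const _
    rw [hΦ i hi, hd.deriv, ih1]
    ext j
    simp only [Pi.smul_apply, Pi.add_apply, smul_eq_mul]
    rw [framePoly.eq_3]
    by_cases he : Even i
    · have he1 : ¬ Even (i + 1) := by grind
      have he2 : Even (i + 2) := by grind
      rw [if_pos he, if_neg he1, if_neg he1, if_pos he2]
      ring
    · have he1 : Even (i + 1) := by grind
      have he2 : ¬ Even (i + 2) := by grind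
      rw [if_neg he, if_pos he1, if_pos he1, if_neg he2]
      ring

lemma blockFrame_row {k : ℕ} (ε κ lam x y : ℕ → ℝ) (p : Fin (2 * k + 1)) :
    (fun j => blockFrame k ε κ lam x y p j) = fun j : Fin (2 * k + 1) =>
      (if Even ((p : ℕ) + 1) then y j else x j) *
        framePoly ε (shapeCoeff κ) (node k lam (j / 2 + 1)) (p + 1) := by
  ext j
  simp only [blockFrame, Matrix.of_apply, oddVec, evenVec]
  split_ifs <;> ring

/-- `blockFrame_gram` concerns the columns; `gram_transpose` turns it into pseudo-orthonormality of
the rows. -/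
lemma lor_blockFrame_row {k : ℕ} {ε κ lam x y : ℕ → ℝ}
    (hε : ∀ i ∈ Set.Icc 1 (2 * k + 1), ε i = 1 ∨ ε i = -1)
    (hgram : (blockFrame k ε κ lam x y).transpose * signMatrix (2 * k + 1) ε *
      blockFrame k ε κ lam x y = metric (2 * k + 1)) (p : Fin (2 * k + 1)) :
    lor (fun j => blockFrame k ε κ lam x y p j) (fun j => blockFrame k ε κ lam x y p j) =
      ε (p + 1) := by
  have h := gram_transpose (signMatrix_mul_signMatrix hε) (metric_mul_metric _) hgram
  have h := congrFun (congrFun h p) p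
  rw [signMatrix, Matrix.diagonal_apply_eq] at h
  rw [← h, lor_eq_sum, metric, Matrix.mul_apply]
  simp only [Matrix.mul_diagonal, Matrix.transpose_apply]
  exact Finset.sum_congr rfl fun _ _ => by ring


/-! ### Nodes from eigenvalues, and what a model satisfies -/

section

variable {k : ℕ} {ε κ lam : ℕ → ℝ}

lemma isNode_node (hε : ∀ i ∈ Set.Icc 1 (2 * k + 1), ε i = 1 ∨ ε i = -1)
    (hκ : ∀ i ∈ Set.Icc 1 (2 * k), κ i ≠ 0) (hpos : ∀ i ∈ Set.Icc 1 k, 0 < lam i)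
    (heig : ∀ i ∈ Set.Icc 1 k, Module.End.HasEigenvalue
      (Matrix.toLin' (frameMatrix (2 * k + 1) ε κ ^ 2)) (sqEigenvalue lam i)) {l : ℕ} (hl : l < k) :
    IsNode k ε κ (node k lam (l + 1)) := by
  have hi : l + 1 ∈ Set.Icc 1 k := ⟨by omega, by omega⟩
  rw [node, if_neg (by omega)]
  refine isNode_of_hasEigenvalue hε hκ ?_ (heig _ hi)
  have := hpos _ hi
  unfold sqEigenvalue
  split_ifs
  · positivity
  · exact neg_ne_zero.2 (by positivity)

lemma node_ne (hpos : ∀ i ∈ Set.Icc 1 k, 0 < lam i)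
    (hdiff : Set.InjOn (sqEigenvalue lam) (Set.Icc 1 k)) :
    ∀ l ≤ k, ∀ l' ≤ k, l ≠ l' → node k lam (l + 1) ≠ node k lam (l' + 1) := by
  have h0 : ∀ l < k, node k lam (l + 1) ≠ 0 := by
    intro l hl
    have := hpos (l + 1) ⟨by omega, by omega⟩
    rw [node, if_neg (by omega)]
    unfold sqEigenvalue
    split_ifs
    · positivity
    · exact neg_ne_zero.2 (by positivity)
  intro l hl l' hl' h
  rcases hl.lt_or_eq with hlt | rfl
  · rcases hl'.lt_or_eq with hlt' | rfl
    · rw [node, if_neg (by omega), node, if_neg (by omega)]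
      intro heq
      have := hdiff ⟨by omega, by omega⟩ ⟨by omega, by omega⟩ heq
      omega
    · rw [node_last]
      exact h0 l hlt
  · rw [node_last]
    exact (h0 l' (by omega)).symm

/-- Even vectors avoid the timelike index `1`, so they have positive square and the odd square has
the sign of `-t`: negative for `lam 1 ^ 2`, positive for the `-lam i ^ 2`. For `t = 0` this says
nothing; there the odd vector is orthogonal to the negative one of the first block. -/
lemma squared_length_of_timelike_fst (hk : 1 ≤ k)
    (hε : ∀ i ∈ Set.Icc 1 (2 * k + 1), ε i = 1 ∨ ε i = -1)
    (hκ : ∀ i ∈ Set.Icc 1 (2 * k), κ i ≠ 0) (h1 : ε 1 = -1)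
    (hε1 : ∀ i ∈ Set.Icc 1 (2 * k + 1), i ≠ 1 → ε i = 1)
    (hlam : ∀ l < k, lam (l + 1) ≠ 0)
    (hnode : ∀ l < k, IsNode k ε κ (node k lam (l + 1)))
    (hinj : ∀ l ≤ k, ∀ l' ≤ k, l ≠ l' → node k lam (l + 1) ≠ node k lam (l' + 1)) :
    0 < ε 1 * frameForm ε (oddVec (2 * k + 1) ε κ (node k lam 1))
      (oddVec (2 * k + 1) ε κ (node k lam 1)) ∧
    ∀ l, 1 ≤ l → l ≤ k → 0 < frameForm ε (oddVec (2 * k + 1) ε κ (node k lam (l + 1)))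
      (oddVec (2 * k + 1) ε κ (node k lam (l + 1))) := by
  have hW := frameForm_evenVec_pos hk κ hε1
  have hneg : frameForm ε (oddVec (2 * k + 1) ε κ (node k lam 1))
      (oddVec (2 * k + 1) ε κ (node k lam 1)) < 0 := by
    have h := hlam 0 (by omega)
    rw [frameForm_oddVec hε hκ _ (hnode 0 (by omega)), node_of_lt lam (l := 0) (by omega)]
    have hp : 0 < lam (0 + 1) ^ 2 := by positivity
    have hs : blockSign (0 + 1) = -1 := if_pos rfl
    rw [hs]
    nlinarith [mul_pos hp (hW (- -1 * lam (0 + 1) ^ 2))]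
  refine ⟨by rw [h1]; linarith, fun l hl1 hl => ?_⟩
  rcases hl.lt_or_eq with hlt | rfl
  · have h := hlam l hlt
    rw [frameForm_oddVec hε hκ _ (hnode l hlt), node_of_lt lam hlt]
    have hp : 0 < lam (l + 1) ^ 2 := by positivity
    have hs : blockSign (l + 1) = 1 := if_neg (by omega)
    rw [hs]
    nlinarith [mul_pos hp (hW (-1 * lam (l + 1) ^ 2))]
  · have h := frameForm_oddVec_of_ne hε hκ hnode hinj (l := l) (l' := 0) le_rfl (by omega)
      (by omega)
    rw [node_last] at h ⊢
    exact frameForm_oddVec_zero_pos hε1 hneg h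

/-- A curve whose coordinates have the derivatives `e^{κ_1 σ}` times `tangentCoord` is p-similar
to `α`, and the vectors `Φ` that it determines are pseudo-orthonormal. -/
theorem model_spec (hk : 1 ≤ k) {I : Set ℝ} (hI : IsOpen I) (hIc : I.OrdConnected)
    (hne : I.Nonempty) {α : ℝ → Fin (2 * k + 1) → ℝ} {e : ℕ → ℝ → Fin (2 * k + 1) → ℝ}
    (hα : IsFrenetCurve I α e ε) (hσ : IsSphericalArcLength I e)
    (hκ : ∀ i ∈ Set.Icc 1 (2 * k), κ i ≠ 0) (hself : IsSelfSimilarWith I α e κ)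
    (hlam : ∀ l < k, lam (l + 1) ≠ 0)
    (hnode : ∀ l < k, IsNode k ε κ (node k lam (l + 1)))
    (hinj : ∀ l ≤ k, ∀ l' ≤ k, l ≠ l' → node k lam (l + 1) ≠ node k lam (l' + 1))
    {a : ℕ → ℝ}
    (hw : ∀ l ≤ k, blockWeight k (κ 1) (ε 1) a (l + 1) *
      frameForm ε (oddVec (2 * k + 1) ε κ (node k lam (l + 1)))
        (oddVec (2 * k + 1) ε κ (node k lam (l + 1))) = 1)
    {P Q : ℝ → ℝ} (hP : ∀ σ, HasDerivAt P (lam 1 * Q σ) σ)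
    (hQ : ∀ σ, HasDerivAt Q (lam 1 * P σ) σ) (hPQ : ∀ σ, -P σ ^ 2 + Q σ ^ 2 = ε 1 * a 1 ^ 2)
    {β : ℝ → Fin (2 * k + 1) → ℝ}
    (hβ : ∀ σ (j : Fin (2 * k + 1)), HasDerivAt (fun s => β s j)
      (Real.exp (κ 1 * σ) * tangentCoord k (κ 1) lam a P Q σ j) σ)
    {Φ : ℕ → ℝ → Fin (2 * k + 1) → ℝ} (h0 : Φ 0 = 0)
    (h1 : ∀ σ, Φ 1 σ = Real.exp (-(κ 1 * σ)) • deriv β σ)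
    (hΦ : ∀ i, i + 2 ≤ 2 * k + 1 → ∀ σ, Φ (i + 2) σ = (ε (i + 2) / shapeCoeff κ (i + 1)) •
      (deriv (Φ (i + 1)) σ + (ε i * shapeCoeff κ i) • Φ i σ)) :
    (∃ f, IsPSimilarity f ∧ ∀ σ ∈ I, f (α σ) = β σ) ∧
    (∀ i ∈ Set.Icc 1 (2 * k + 1), ∀ σ, lor (Φ i σ) (Φ i σ) = ε i) ∧
    ε 1 * a 1 ^ 2 + ∑ i ∈ Finset.Icc 2 k, a i ^ 2 + κ 1 ^ 2 * a (k + 1) ^ 2 = ε 1 ∧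
    -ε 1 * a 1 ^ 2 * lam 1 ^ 2 + ∑ i ∈ Finset.Icc 2 k, a i ^ 2 * lam i ^ 2 = ε 2 ∧
    ε 1 * a 1 ^ 2 * (ε 1 + ε 2 * lam 1 ^ 2) ^ 2 +
      ∑ i ∈ Finset.Icc 2 k, (ε 1 - ε 2 * lam i ^ 2) ^ 2 * a i ^ 2 +
      κ 1 ^ 2 * a (k + 1) ^ 2 = ε 3 * κ 2 ^ 2 := by
  have hε := hα.sign
  set x := tangentCoord k (κ 1) lam a P Q with hx
  set y := normalCoord k (κ 1) lam a P Q with hy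
  have hxd : ∀ σ, ∀ j < 2 * k + 1, HasDerivAt (fun s => x s j) (y σ j) σ := fun σ j hj =>
    hasDerivAt_tangentCoord hP hQ σ hj
  have hyd : ∀ σ, ∀ j < 2 * k + 1, HasDerivAt (fun s => y s j)
      (node k lam (j / 2 + 1) * x σ j) σ := fun σ j hj => hasDerivAt_normalCoord hP hQ σ hj
  have hxy : ∀ σ, IsBlockValue k lam (blockWeight k (κ 1) (ε 1) a) (x σ) (y σ) :=
    isBlockValue_tangentCoord hk hlam hPQ
  have hgram := fun σ => blockFrame_gram hε hκ hlam hnode hinj hk (hxy σ) hw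
  have hx1 : ∀ σ, Φ 1 σ = fun j : Fin (2 * k + 1) => x σ j := by
    intro σ
    rw [h1, (hasDerivAt_pi.2 (hβ σ)).deriv]
    ext j
    simp only [Pi.smul_apply, smul_eq_mul]
    rw [← mul_assoc, ← Real.exp_add, neg_add_cancel, Real.exp_zero, one_mul]
  have hrow : ∀ (p : Fin (2 * k + 1)) σ,
      Φ (p + 1) σ = fun j => blockFrame k ε κ lam (x σ) (y σ) p j := by
    intro p σ
    rw [blockFrame_row, frame_eq h0 hx1 hΦ hxd hyd (p + 1) (by omega)]
  have hlor := fun σ => lor_blockFrame_row hε (hgram σ)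
  -- `Finset.Ioc 1 k` and `Finset.Icc 2 k` agree by definition.
  have hsplit : ∀ g : ℕ → ℝ, ∑ i ∈ Finset.Icc 1 k, g i = g 1 + ∑ i ∈ Finset.Icc 2 k, g i :=
    fun g => (Finset.add_sum_Ioc_eq_sum_Icc hk).symm
  have w1 : blockWeight k (κ 1) (ε 1) a 1 = ε 1 * a 1 ^ 2 := if_pos rfl
  have wl : ∀ l ∈ Finset.Icc 2 k, blockWeight k (κ 1) (ε 1) a l = a l ^ 2 := by
    intro l hl
    rw [Finset.mem_Icc] at hl
    rw [blockWeight, if_neg (by omega), if_neg (by omega)]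
  have wk : blockWeight k (κ 1) (ε 1) a (k + 1) = κ 1 ^ 2 * a (k + 1) ^ 2 := by
    rw [blockWeight, if_neg (by omega), if_pos rfl]
  have t1 : sqEigenvalue lam 1 = lam 1 ^ 2 := if_pos rfl
  have tl : ∀ l ∈ Finset.Icc 2 k, sqEigenvalue lam l = -lam l ^ 2 := by
    intro l hl
    rw [Finset.mem_Icc] at hl
    exact if_neg (by omega)
  have hsq : ∀ i ∈ Set.Icc 1 (2 * k + 1), ε i ^ 2 = 1 := fun i hi => by
    rcases hε i hi with h | h <;> rw [h] <;> norm_num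
  have q2 : ∀ t, framePoly ε (shapeCoeff κ) t 2 = ε 2 := by
    intro t
    simp [framePoly, shapeCoeff]
  have q3 : ∀ t, framePoly ε (shapeCoeff κ) t 3 = ε 3 / κ 2 * (t * ε 2 + ε 1) := by
    intro t
    rw [framePoly.eq_3, q2]
    simp [framePoly, shapeCoeff]
  refine ⟨exists_isPSimilarity hk hI hIc hne hα hσ (hκ 1 ⟨le_rfl, by omega⟩) hself
    (hasDerivAt_blockFrame hε hκ hnode hxd hyd (fun σ => (hxy σ).last)) hgram ?_, ?_, ?_, ?_, ?_⟩
  · intro σ j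
    refine (hβ σ j).congr_deriv ?_
    simp [blockFrame, oddVec, evenVec, framePoly]
  · intro i hi σ
    have := hrow ⟨i - 1, by have := hi.2; omega⟩ σ
    have hi' : i - 1 + 1 = i := Nat.sub_add_cancel hi.1
    rw [← hi']
    simp only at this
    rw [this, hlor]
  -- The three equations are the squared lengths of rows 1, 2 and 3 at `σ = 0`, computed block by
  -- block with `lor_row`.
  · have h := hlor 0 0
    rw [blockFrame_row] at h
    have h2 := (lor_row hk (hxy 0) (fun t => framePoly ε (shapeCoeff κ) t 1)).1
    simp only [Fin.val_zero, zero_add, Nat.not_even_one, if_false] at h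
    rw [h, hsplit, w1, wk] at h2
    rw [Finset.sum_congr rfl (fun l hl => by rw [wl l hl])] at h2
    simp only [framePoly, one_pow, mul_one] at h2
    linarith
  · have h := hlor 0 ⟨1, by omega⟩
    rw [blockFrame_row] at h
    have h2 := (lor_row hk (hxy 0) (fun t => framePoly ε (shapeCoeff κ) t 2)).2
    simp only [Nat.reduceAdd, even_two, if_true] at h
    simp only [q2, hsq 2 ⟨by omega, by omega⟩, mul_one] at h h2
    rw [h, hsplit, w1, t1, Finset.sum_congr rfl (fun l hl => by rw [wl l hl, tl l hl])] at h2
    simp only [mul_neg, neg_neg] at h2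
    linarith
  · have h := hlor 0 ⟨2, by omega⟩
    rw [blockFrame_row] at h
    have h2 := (lor_row hk (hxy 0) (fun t => framePoly ε (shapeCoeff κ) t 3)).1
    have h3 : ¬ Even 3 := by decide
    simp only [Nat.reduceAdd, h3, if_false] at h
    have hκ2 : κ 2 ≠ 0 := hκ 2 ⟨by omega, by omega⟩
    have q3' : ∀ t, framePoly ε (shapeCoeff κ) t 3 ^ 2 = (t * ε 2 + ε 1) ^ 2 / κ 2 ^ 2 := by
      intro t
      rw [q3, mul_pow, div_pow, hsq 3 ⟨by omega, by omega⟩]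
      ring
    simp only [q3'] at h2
    rw [h, hsplit, w1, wk, t1, Finset.sum_congr rfl (fun l hl => by rw [wl l hl, tl l hl])] at h2
    rw [h2, add_mul, add_mul, Finset.sum_mul]
    congr 1
    · congr 1
      · field_simp
        ring
      · refine Finset.sum_congr rfl fun l _ => ?_
        field_simp
        ring
    · have := hsq 1 ⟨by omega, by omega⟩
      field_simp
      linear_combination -κ 1 ^ 2 * a (k + 1) ^ 2 * this

end

/-! ### The two models -/

lemma hasDerivAt_exp_mul {g : ℝ → ℝ} {g' σ : ℝ} (c r : ℝ) (hg : HasDerivAt g g' σ) :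
    HasDerivAt (fun s => r * Real.exp (c * s) * g s)
      (Real.exp (c * σ) * (r * (c * g σ + g'))) σ := by
  have h1 := ((((hasDerivAt_id σ).const_mul c).exp).const_mul r).mul hg
  refine h1.congr_deriv ?_
  simp only [id]
  ring

lemma hasDerivAt_timelikeModel (k : ℕ) (c : ℝ) (lam a : ℕ → ℝ) (σ : ℝ) (j : Fin (2 * k + 1)) :
    HasDerivAt (fun s => timelikeModel k c lam a s j) (Real.exp (c * σ) * tangentCoord k c lam a
      (fun s => a 1 / bCoeff c lam 1 *
        (c * Real.sinh (phase c lam 1 s) + lam 1 * Real.cosh (phase c lam 1 s)))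
      (fun s => a 1 / bCoeff c lam 1 *
        (c * Real.cosh (phase c lam 1 s) + lam 1 * Real.sinh (phase c lam 1 s))) σ j) σ := by
  have hθ := hasDerivAt_phase c lam (j / 2 + 1) σ
  simp only [timelikeModel, tangentCoord]
  split_ifs with h1 h2 h3 h4
  · refine (((((hasDerivAt_id σ).const_mul c).exp).const_mul (a (k + 1)))).congr_deriv ?_
    simp only [id]
    ring
  · rw [h2] at hθ ⊢
    refine (hasDerivAt_exp_mul c _ hθ.sinh).congr_deriv ?_
    simp only [Nat.zero_div, zero_add]
    ring
  · rw [h3] at hθ ⊢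
    refine (hasDerivAt_exp_mul c _ hθ.cosh).congr_deriv ?_
    simp only [Nat.reduceDiv, zero_add]
    ring
  · refine (hasDerivAt_exp_mul c _ hθ.sin).congr_deriv ?_
    ring
  · simp only [neg_mul]
    refine (hasDerivAt_exp_mul c _ hθ.cos).neg.congr_deriv ?_
    ring

lemma hasDerivAt_spacelikeModel (k : ℕ) (c : ℝ) (lam a : ℕ → ℝ) (σ : ℝ) (j : Fin (2 * k + 1)) :
    HasDerivAt (fun s => spacelikeModel k c lam a s j) (Real.exp (c * σ) * tangentCoord k c lam a
      (fun s => -(a 1 / bCoeff c lam 1) *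
        (c * Real.cosh (phase c lam 1 s) + lam 1 * Real.sinh (phase c lam 1 s)))
      (fun s => -(a 1 / bCoeff c lam 1) *
        (c * Real.sinh (phase c lam 1 s) + lam 1 * Real.cosh (phase c lam 1 s))) σ j) σ := by
  have hθ := hasDerivAt_phase c lam (j / 2 + 1) σ
  simp only [spacelikeModel, tangentCoord]
  split_ifs with h1 h2 h3 h4
  · refine (((((hasDerivAt_id σ).const_mul c).exp).const_mul (a (k + 1)))).congr_deriv ?_
    simp only [id]
    ring
  · rw [h2] at hθ ⊢
    simp only [neg_mul]
    refine (hasDerivAt_exp_mul c _ hθ.cosh).neg.congr_deriv ?_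
    simp only [Nat.zero_div, zero_add]
    ring
  · rw [h3] at hθ ⊢
    simp only [neg_mul]
    refine (hasDerivAt_exp_mul c _ hθ.sinh).neg.congr_deriv ?_
    simp only [Nat.reduceDiv, zero_add]
    ring
  · refine (hasDerivAt_exp_mul c _ hθ.sin).congr_deriv ?_
    ring
  · simp only [neg_mul]
    refine (hasDerivAt_exp_mul c _ hθ.cos).neg.congr_deriv ?_
    ring

/-! ### The two frame recursions as one recursion with signs -/

section

variable {n : ℕ} {ε κ : ℕ → ℝ} (β : ℝ → Fin n → ℝ)

lemma timelikeFrame_rec (h1 : ε 1 = -1) (hε : ∀ i ∈ Set.Icc 1 n, i ≠ 1 → ε i = 1) {i : ℕ}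
    (hi : i + 2 ≤ n) (σ : ℝ) :
    timelikeFrame κ β (i + 2) σ = (ε (i + 2) / shapeCoeff κ (i + 1)) •
      (deriv (timelikeFrame κ β (i + 1)) σ + (ε i * shapeCoeff κ i) • timelikeFrame κ β i σ) := by
  rw [hε (i + 2) ⟨by omega, hi⟩ (by omega)]
  match i with
  | 0 => simp [timelikeFrame, shapeCoeff]
  | 1 => simp [timelikeFrame, shapeCoeff, h1, add_comm]
  | i + 2 =>
    rw [hε (i + 2) ⟨by omega, by omega⟩ (by omega),
      add_comm (deriv _ _)]
    simp [timelikeFrame, shapeCoeff]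

lemma spacelikeFrame_rec (h2 : ε 2 = -1) (hε : ∀ i ∈ Set.Icc 1 n, i ≠ 2 → ε i = 1) {i : ℕ}
    (hi : i + 2 ≤ n) (σ : ℝ) :
    spacelikeFrame κ β (i + 2) σ = (ε (i + 2) / shapeCoeff κ (i + 1)) •
      (deriv (spacelikeFrame κ β (i + 1)) σ + (ε i * shapeCoeff κ i) • spacelikeFrame κ β i σ) := by
  match i with
  | 0 => simp [spacelikeFrame, shapeCoeff, h2]
  | 1 =>
    rw [hε 1 ⟨le_rfl, by omega⟩ (by omega), hε (1 + 2) ⟨by omega, hi⟩ (by omega)]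
    simp [spacelikeFrame, shapeCoeff, add_comm]
  | 2 =>
    rw [hε (2 + 2) ⟨by omega, hi⟩ (by omega)]
    simp [spacelikeFrame, shapeCoeff, h2, add_comm]
  | i + 3 =>
    rw [hε (i + 3) ⟨by omega, by omega⟩ (by omega), hε (i + 3 + 2) ⟨by omega, hi⟩ (by omega),
      add_comm (deriv _ _)]
    simp [spacelikeFrame, shapeCoeff]

end

end Minkowski
-- The two cases of the theorem
theorem mainTheorem5 (k : ℕ) (hk : 1 ≤ k)
    (I : Set ℝ) (hI : IsOpen I) (hIc : I.OrdConnected) (hne : I.Nonempty)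
    (α : ℝ → Fin (2 * k + 1) → ℝ) (e : ℕ → ℝ → Fin (2 * k + 1) → ℝ) (ε : ℕ → ℝ)
    (hα : Minkowski.IsFrenetCurve I α e ε)
    (hσ : Minkowski.IsSphericalArcLength I e)
    (κ : ℕ → ℝ) (hκ : ∀ i ∈ Set.Icc 1 (2 * k), κ i ≠ 0)
    (hself : Minkowski.IsSelfSimilarWith I α e κ)
    (lam : ℕ → ℝ) (hpos : ∀ i ∈ Set.Icc 1 k, 0 < lam i)
    (heig : ∀ i ∈ Set.Icc 1 k, Module.End.HasEigenvalue
      (Matrix.toLin' (Minkowski.frameMatrix (2 * k + 1) ε κ ^ 2))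
      (Minkowski.sqEigenvalue lam i))
    (hdiff : Set.InjOn (Minkowski.sqEigenvalue lam) (Set.Icc 1 k))
    (hb : κ 1 ^ 2 < lam 1 ^ 2) :
    (ε 1 = -1 → ∃ a : ℕ → ℝ, (∀ i ∈ Set.Icc 1 (k + 1), a i ≠ 0) ∧
      (∃ f : (Fin (2 * k + 1) → ℝ) → (Fin (2 * k + 1) → ℝ), Minkowski.IsPSimilarity f ∧
        ∀ σ ∈ I, f (α σ) = Minkowski.timelikeModel k (κ 1) lam a σ) ∧
      (let E := Minkowski.timelikeFrame κ (Minkowski.timelikeModel k (κ 1) lam a);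
        (∀ σ, Minkowski.lor (E 1 σ) (E 1 σ) = -1) ∧
        (∀ i, (i = 2 ∨ i = 3 ∨ (4 ≤ i ∧ i ≤ k + 1)) →
          ∀ σ, Minkowski.lor (E i σ) (E i σ) = 1)) ∧
      -a 1 ^ 2 + ∑ i ∈ Finset.Icc 2 k, a i ^ 2 + κ 1 ^ 2 * a (k + 1) ^ 2 = -1 ∧
      ∑ i ∈ Finset.Icc 1 k, a i ^ 2 * lam i ^ 2 = 1 ∧
      -a 1 ^ 2 * (1 - lam 1 ^ 2) ^ 2 + ∑ i ∈ Finset.Icc 2 k, (1 + lam i ^ 2) ^ 2 * a i ^ 2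
        + κ 1 ^ 2 * a (k + 1) ^ 2 = κ 2 ^ 2) ∧
    (ε 2 = -1 → ∃ a : ℕ → ℝ, (∀ i ∈ Set.Icc 1 (k + 1), a i ≠ 0) ∧
      (∃ f : (Fin (2 * k + 1) → ℝ) → (Fin (2 * k + 1) → ℝ), Minkowski.IsPSimilarity f ∧
        ∀ σ ∈ I, f (α σ) = Minkowski.spacelikeModel k (κ 1) lam a σ) ∧
      (let E := Minkowski.spacelikeFrame κ (Minkowski.spacelikeModel k (κ 1) lam a);
        (∀ σ, Minkowski.lor (E 2 σ) (E 2 σ) = -1) ∧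
        (∀ i, (i = 1 ∨ i = 3 ∨ (4 ≤ i ∧ i ≤ k + 1)) →
          ∀ σ, Minkowski.lor (E i σ) (E i σ) = 1)) ∧
      ∑ i ∈ Finset.Icc 1 k, a i ^ 2 + κ 1 ^ 2 * a (k + 1) ^ 2 = 1 ∧
      -a 1 ^ 2 * lam 1 ^ 2 + ∑ i ∈ Finset.Icc 2 k, a i ^ 2 * lam i ^ 2 = -1 ∧
      a 1 ^ 2 * (1 - lam 1 ^ 2) ^ 2 + ∑ i ∈ Finset.Icc 2 k, (1 + lam i ^ 2) ^ 2 * a i ^ 2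
        + κ 1 ^ 2 * a (k + 1) ^ 2 = κ 2 ^ 2) := by
  have hε := hα.sign
  have hlam : ∀ l < k, lam (l + 1) ≠ 0 := fun l hl => (hpos _ ⟨by omega, by omega⟩).ne'
  have hnode : ∀ l < k, Minkowski.IsNode k ε κ (Minkowski.node k lam (l + 1)) := fun l hl =>
    Minkowski.isNode_node hε hκ hpos heig hl
  have hinj := Minkowski.node_ne hpos hdiff
  have hκ1 : κ 1 ≠ 0 := hκ 1 ⟨le_rfl, by omega⟩
  have hbsq := Minkowski.bCoeff_one_sq hb
  have hb0 : Minkowski.bCoeff (κ 1) lam 1 ≠ 0 := by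
    intro h
    rw [h] at hbsq
    linarith
  have hθ := Minkowski.hasDerivAt_phase (κ 1) lam 1
  refine ⟨fun h1 => ?_, fun h2 => ?_⟩
  · have hε1 : ∀ i ∈ Set.Icc 1 (2 * k + 1), i ≠ 1 → ε i = 1 := fun i hi hi1 =>
      hα.sign_eq_one hne ⟨le_rfl, by omega⟩ hi hi1.symm h1
    obtain ⟨hN1, hN⟩ :=
      Minkowski.squared_length_of_timelike_fst hk hε hκ h1 hε1 hlam hnode hinj
    obtain ⟨a, ha, hw⟩ := Minkowski.exists_coefficients (N := fun l => Minkowski.frameForm ε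
      (Minkowski.oddVec (2 * k + 1) ε κ (Minkowski.node k lam l))
      (Minkowski.oddVec (2 * k + 1) ε κ (Minkowski.node k lam l))) hk hκ1 (Or.inr h1) hN1 hN
    obtain ⟨hsim, hlor, eq1, eq2, eq3⟩ := Minkowski.model_spec hk hI hIc hne hα hσ hκ hself hlam
      hnode hinj hw
      (fun σ => ((((hθ σ).sinh.const_mul (κ 1)).fun_add
        ((hθ σ).cosh.const_mul (lam 1))).const_mul _).congr_deriv (by ring))
      (fun σ => ((((hθ σ).cosh.const_mul (κ 1)).fun_add
        ((hθ σ).sinh.const_mul (lam 1))).const_mul _).congr_deriv (by ring))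
      -- The squared length is `(a_1/b_1)² (κ̃_1² - λ_1²) = -a_1²`. In the spacelike case `P` and
      -- `Q` trade roles up to sign, which gives `+a_1²`.
      (fun σ => by
        have := Real.cosh_sq (Minkowski.phase (κ 1) lam 1 σ)
        field_simp
        rw [h1, hbsq]
        linear_combination a 1 ^ 2 * (κ 1 ^ 2 - lam 1 ^ 2) * this)
      (Minkowski.hasDerivAt_timelikeModel k (κ 1) lam a)
      (Φ := Minkowski.timelikeFrame κ (Minkowski.timelikeModel k (κ 1) lam a)) rfl
      (fun _ => rfl) (fun i hi σ => Minkowski.timelikeFrame_rec _ h1 hε1 hi σ)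
    have e2 := hε1 2 ⟨by omega, by omega⟩ (by omega)
    have e3 := hε1 3 ⟨by omega, by omega⟩ (by omega)
    refine ⟨a, ha, hsim, ⟨fun σ => ?_, fun i hi σ => ?_⟩, ?_, ?_, ?_⟩
    · rw [hlor 1 ⟨le_rfl, by omega⟩, h1]
    · rw [hlor i ⟨by omega, by omega⟩, hε1 i ⟨by omega, by omega⟩ (by omega)]
    · rw [h1] at eq1
      linarith
    · rw [h1, e2] at eq2
      rw [← Finset.add_sum_Ioc_eq_sum_Icc hk]
      change a 1 ^ 2 * lam 1 ^ 2 + ∑ i ∈ Finset.Icc 2 k, a i ^ 2 * lam i ^ 2 = 1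
      linarith
    · rw [h1, e2, e3] at eq3
      rw [← one_mul (κ 2 ^ 2), ← eq3]
      congr 2
      · ring
      · exact Finset.sum_congr rfl fun i _ => by ring
  · have hε2 : ∀ i ∈ Set.Icc 1 (2 * k + 1), i ≠ 2 → ε i = 1 := fun i hi hi1 =>
      hα.sign_eq_one hne ⟨by omega, by omega⟩ hi hi1.symm h2
    have h1 := hε2 1 ⟨by omega, by omega⟩ (by omega)
    -- With `e 2` timelike, odd vectors avoid the negative direction, so all their squares are
    -- positive whatever the node.
    have hN := Minkowski.frameForm_oddVec_pos κ hε2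
    obtain ⟨a, ha, hw⟩ := Minkowski.exists_coefficients (N := fun l => Minkowski.frameForm ε
      (Minkowski.oddVec (2 * k + 1) ε κ (Minkowski.node k lam l))
      (Minkowski.oddVec (2 * k + 1) ε κ (Minkowski.node k lam l))) hk hκ1 (Or.inl h1)
      (by rw [h1, one_mul]; exact hN _) (fun l _ _ => hN _)
    obtain ⟨hsim, hlor, eq1, eq2, eq3⟩ := Minkowski.model_spec hk hI hIc hne hα hσ hκ hself hlam
      hnode hinj hw
      (fun σ => ((((hθ σ).cosh.const_mul (κ 1)).fun_add
        ((hθ σ).sinh.const_mul (lam 1))).const_mul _).congr_deriv (by ring))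
      (fun σ => ((((hθ σ).sinh.const_mul (κ 1)).fun_add
        ((hθ σ).cosh.const_mul (lam 1))).const_mul _).congr_deriv (by ring))
      (fun σ => by
        have := Real.cosh_sq (Minkowski.phase (κ 1) lam 1 σ)
        field_simp
        rw [h1, hbsq]
        linear_combination a 1 ^ 2 * (lam 1 ^ 2 - κ 1 ^ 2) * this)
      (Minkowski.hasDerivAt_spacelikeModel k (κ 1) lam a)
      (Φ := Minkowski.spacelikeFrame κ (Minkowski.spacelikeModel k (κ 1) lam a)) rfl
      (fun _ => rfl) (fun i hi σ => Minkowski.spacelikeFrame_rec _ h2 hε2 hi σ)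
    have e3 := hε2 3 ⟨by omega, by omega⟩ (by omega)
    refine ⟨a, ha, hsim, ⟨fun σ => ?_, fun i hi σ => ?_⟩, ?_, ?_, ?_⟩
    · rw [hlor 2 ⟨by omega, by omega⟩, h2]
    · rw [hlor i ⟨by omega, by omega⟩, hε2 i ⟨by omega, by omega⟩ (by omega)]
    · rw [h1] at eq1
      rw [← Finset.add_sum_Ioc_eq_sum_Icc hk]
      change a 1 ^ 2 + ∑ i ∈ Finset.Icc 2 k, a i ^ 2 + κ 1 ^ 2 * a (k + 1) ^ 2 = 1
      linarith
    · rw [h1, h2] at eq2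
      linarith
    · rw [h1, h2, e3] at eq3
      rw [← one_mul (κ 2 ^ 2), ← eq3]
      congr 2
      · ring
      · exact Finset.sum_congr rfl fun i _ => by ring
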